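/- Let $0<\epsilon<1$ and $r>0$ be constants. For each sufficiently large integer $n$ let $p_2=\frac{1-\epsilon}{n}$ and $p_3=\frac{r}{n\ln n}$ (both lie in $[0,1]$), and let $\mathbb{G}=\mathbb{G}(n,p_2,p_3)$ be the random hypergraph on $n$ labelled vertices in which, all choices being independent, each set of two vertices is an edge with probability $p_2$ and each set of three vertices is an edge with probability $p_3$. A hypergraph on $n$ vertices with all edges of size $2$ or $3$ is called propagation connected if it has edges $e_1,\dots,e_{n-1}$ such that $\left|e_{l+1}\cap\bigcup_{i=1}^{l}e_i\right|=|e_{l+1}|-1$ for every integer $1\le l\le n-2$. Put $\lambda(\omega)=1-\epsilon+r\omega$ and $$I_{\epsilon,r}=\int_0^{\epsilon/r}\bigl[1-\lambda(\omega)+\ln\lambda(\omega)\bigr]\,d\omega .$$ Then $$I_{\epsilon,r}=-\frac1r\left[\epsilon-\frac{\epsilon^2}{2}+(1-\epsilon)\ln(1-\epsilon)\right],$$ and the following hold. (1) If $I_{\epsilon,r}<-1$, then $\lim_{n\to\infty}\Pr[\mathbb{G}\text{ is not propagation connected}]=1$. (2) If $I_{\epsilon,r}>-1$, then $\lim_{n\to\infty}\Pr[\mathbb{G}\text{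 is propagation connected}]=1$. -/

import Mathlib

open MeasureTheory ProbabilityTheory Filter Topology

/-- A finite hypergraph on `n` vertices is propagation connected if it has edges
`e 1, …, e (n - 1)` such that, for `1 ≤ l ≤ n - 2`, all vertices of `e (l + 1)` except exactly one
lie in `e 1 ∪ ⋯ ∪ e l`. (Only the values `e 1, …, e (n - 1)` matter; `m + 1 = |e (l + 1)|` is the
subtraction-free form of `m = |e (l + 1)| - 1`.) -/
def Hypergraph.PropagationConnected {V : Type*} [Finite V] (H : Hypergraph V) : Prop :=
  ∃ e : ℕ → Set V,
    (∀ i, 1 ≤ i → i ≤ H.vertexSet.ncard - 1 → e i ∈ H.edgeSet) ∧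
    ∀ l, 1 ≤ l → l ≤ H.vertexSet.ncard - 2 →
      (e (l + 1) ∩ ⋃ i ∈ Set.Icc 1 l, e i).ncard + 1 = (e (l + 1)).ncard

/-- The hypergraph on the whole type `V` with edge set `E`. -/
def hypergraphOfEdges {V : Type*} (E : Set (Set V)) : Hypergraph V where
  vertexSet := Set.univ
  edgeSet := E
  subset_vertexSet_of_mem_edgeSet' := fun _ _ => Set.subset_univ _

/-- The joint law of the random set `ω.1` of 2-edges and the random set `ω.2` of 3-edges on the
vertex set `Fin n`: all possible edges appear independently, every set of two vertices with
probability `p₂` and every set of three vertices with probability `p₃`. -/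
noncomputable def randomEdges (n : ℕ) (p₂ p₃ : unitInterval) :
    Measure (Set (Set (Fin n)) × Set (Set (Fin n))) :=
  (setBernoulli {e : Set (Fin n) | e.ncard = 2} p₂).prod
    (setBernoulli {e : Set (Fin n) | e.ncard = 3} p₃)

/-- The random hypergraph `G(n, p₂, p₃)`, as a function on the probability space
given by `randomEdges n p₂ p₃`. -/
def randomHypergraph (n : ℕ) (ω : Set (Set (Fin n)) × Set (Set (Fin n))) : Hypergraph (Fin n) :=
  hypergraphOfEdges (ω.1 ∪ ω.2)

/-- The function `λ(x) = 1 - ε + r x`. -/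
def lam (ε r x : ℝ) : ℝ := 1 - ε + r * x

/-- The constant `I_{ε,r}`. -/
noncomputable def thresholdI (ε r : ℝ) : ℝ :=
  ∫ w in (0 : ℝ)..(ε / r), (1 - lam ε r w + Real.log (lam ε r w))

/-! Write ℓ = ln n. When d vertices have been explored, an unused vertex is linked to the next
vertex v by the 2-edge to v or by one of the d possible 3-edges through v and an explored vertex. So
the number of vertices that v activates is binomial with mean about λ(d/ℓ), below 1 until d reaches
εℓ/r and above 1 afterwards. Keeping the exploration alive through this bottleneck costs, per step,
the Poisson large deviation factor exp(1 - λ + ln λ). The product over d is about exp(ℓ I) = n^I,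
and there are n starting vertices, whence the threshold I = -1.

The independence behind both bounds is `expect_resample`. A query made with reached set R only
concerns edges with at most one vertex outside R (`nearlyInside`), while every later query concerns
edges with two vertices outside R. The remaining edges are therefore still fresh.

If I < -1: a propagation connected hypergraph has a vertex from which the exploration never stops
before all vertices are explored (`exists_extending_edge`, `survive_eq_one`). A Chernoff bound with
a tilt depending on time (`expect_survive_le`) and a union bound over the starting vertex give
probability at most n^(1+I).

If I > -1: with y about ℓ^(1/10), a single attempt demands a first layer of size y^9, then y^9
further layers of that size, which carry the exploration past the bottleneck, then layers of sizes
y^16 and y^23. By `le_binomTail` it succeeds with probability at least n^(I-κ), where κ = (1+I)/2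
(`exp_le_growProb`). About n/y^50 attempts on unused vertices make failure of all of them unlikely
(`expect_tryLayers_le`). A reached set of size y^23 exceeds ℓ² by far, and a first moment bound
(`sum_choose_mul_le`) shows that with high probability every proper vertex set that large has a
3-edge with exactly one vertex outside, so the reached set grows to everything. -/

/-! ### Random finite sets with independent membership -/

section RandomSet

variable {ι : Type*} [DecidableEq ι]

/-- The expectation of `f t`, where the random subset `t` of `s` contains each `i ∈ s`
independently with probability `p i`. -/
noncomputable def expectOn (p : ι → ℝ) (s : Finset ι) (f : Finset ι → ℝ) : ℝ :=
  ∑ t ∈ s.powerset, (∏ i ∈ t, p i) * (∏ i ∈ s \ t, (1 - p i)) * f t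

variable {p : ι → ℝ}

@[simp] lemma expectOn_empty (f : Finset ι → ℝ) : expectOn p ∅ f = f ∅ := by
  simp [expectOn]

lemma expectOn_insert {s : Finset ι} {a : ι} (ha : a ∉ s) (f : Finset ι → ℝ) :
    expectOn p (insert a s) f
      = p a * expectOn p s (fun t => f (insert a t)) + (1 - p a) * expectOn p s f := by
  unfold expectOn
  rw [Finset.sum_powerset_insert ha, add_comm, Finset.mul_sum, Finset.mul_sum]
  congr 1
  · refine Finset.sum_congr rfl fun t ht => ?_
    have hat : a ∉ t := fun h => ha (Finset.mem_powerset.1 ht h)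
    rw [Finset.prod_insert hat, Finset.insert_sdiff_insert, Finset.sdiff_insert_of_notMem ha]
    ring
  · refine Finset.sum_congr rfl fun t ht => ?_
    have hat : a ∉ t := fun h => ha (Finset.mem_powerset.1 ht h)
    rw [Finset.insert_sdiff_of_notMem _ hat, Finset.prod_insert (by simp [ha])]
    ring

lemma expectOn_congr {s : Finset ι} {f g : Finset ι → ℝ} (h : ∀ t ⊆ s, f t = g t) :
    expectOn p s f = expectOn p s g :=
  Finset.sum_congr rfl fun t ht => by rw [h t (Finset.mem_powerset.1 ht)]

@[simp] lemma expectOn_const (s : Finset ι) (c : ℝ) : expectOn p s (fun _ => c) = c := by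
  induction s using Finset.induction_on with
  | empty => simp
  | insert a s ha ih => rw [expectOn_insert ha, ih]; ring

lemma expectOn_union {s t : Finset ι} (hst : Disjoint s t) (f : Finset ι → ℝ) :
    expectOn p (s ∪ t) f = expectOn p s (fun u => expectOn p t (fun v => f (u ∪ v))) := by
  induction s using Finset.induction_on generalizing f with
  | empty => simp
  | insert a s ha ih =>
    rw [Finset.disjoint_insert_left] at hst
    rw [Finset.insert_union, expectOn_insert (by simp [ha, hst.1]), ih hst.2, ih hst.2,
      expectOn_insert ha]
    simp [Finset.insert_union]

lemma expectOn_of_eq_zero {s : Finset ι} (h : ∀ i ∈ s, p i = 0) (f : Finset ι → ℝ) :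
    expectOn p s f = f ∅ := by
  induction s using Finset.induction_on generalizing f with
  | empty => simp
  | insert a s ha ih =>
    rw [expectOn_insert ha, h a (by simp), ih (fun i hi => h i (by simp [hi])) f]; ring

variable [Fintype ι]

variable (p) in
/-- The expectation of `f E`, where the random set `E` contains each `i` independently with
probability `p i`. -/
noncomputable def expect (f : Finset ι → ℝ) : ℝ := expectOn p Finset.univ f

@[simp] lemma expect_const (c : ℝ) : expect p (fun _ => c) = c := expectOn_const _ c

/-- Independence of the parts of the random set inside and outside `T`, in the form of an iterated
expectation. -/
lemma expect_split (T : Finset ι) (g : Finset ι → Finset ι → ℝ) :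
    expect p (fun E => g (E ∩ T) (E \ T))
      = expectOn p T (fun t => expectOn p Tᶜ (fun t' => g t t')) := by
  rw [expect, ← Finset.union_compl T, expectOn_union disjoint_compl_right]
  refine expectOn_congr fun t ht => expectOn_congr fun t' ht' => ?_
  have h : ∀ x ∈ t', x ∉ T := fun x hx => Finset.mem_compl.1 (ht' hx)
  congr 1
  · ext x; simp only [Finset.mem_inter, Finset.mem_union]; grind
  · ext x; simp only [Finset.mem_sdiff, Finset.mem_union]; grind

/-- Deferred decisions: if `X` only depends on `E ∩ T` and `G a`, for the values `a` of `X`, only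
depends on `E \ T`, then `E` can be resampled once `X E` is known. -/
lemma expect_resample {α : Type*} (T : Finset ι) (X : Finset ι → α) (G : α → Finset ι → ℝ)
    (hX : ∀ E, X E = X (E ∩ T)) (hG : ∀ E' E, G (X E') E = G (X E') (E \ T)) :
    expect p (fun E => G (X E) E) = expect p (fun E => expect p (G (X E))) := by
  have h1 : (fun E => G (X E) E) = fun E => (fun t t' => G (X t) t') (E ∩ T) (E \ T) := by
    funext E; simp only; rw [← hX, ← hG]
  have h2 : (fun E => expect p (G (X E)))
      = fun E => (fun t _ => expect p (G (X t))) (E ∩ T) (E \ T) := by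
    funext E; simp only; rw [← hX]
  rw [h1, h2, expect_split T (fun t t' => G (X t) t'),
    expect_split T (fun t _ => expect p (G (X t)))]
  refine expectOn_congr fun t _ => ?_
  rw [expectOn_const]
  have h3 : G (X t) = fun E => (fun _ t' => G (X t) t') (E ∩ T) (E \ T) := by
    funext E; simp only; rw [← hG]
  conv_rhs => rw [h3, expect_split T (fun _ t' => G (X t) t')]
  simp

lemma expect_mul_const (f : Finset ι → ℝ) (c : ℝ) :
    expect p (fun E => f E * c) = expect p f * c := by
  simp only [expect, expectOn, Finset.sum_mul, mul_assoc]

lemma expect_const_mul (c : ℝ) (f : Finset ι → ℝ) :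
    expect p (fun E => c * f E) = c * expect p f := by
  simp_rw [mul_comm c]; exact expect_mul_const f c

lemma expect_add (f g : Finset ι → ℝ) :
    expect p (fun E => f E + g E) = expect p f + expect p g := by
  simp only [expect, expectOn, mul_add, Finset.sum_add_distrib]

lemma expect_sub (f g : Finset ι → ℝ) :
    expect p (fun E => f E - g E) = expect p f - expect p g := by
  simp only [expect, expectOn, mul_sub, Finset.sum_sub_distrib]

lemma expect_sum {κ : Type*} (s : Finset κ) (f : κ → Finset ι → ℝ) :
    expect p (fun E => ∑ k ∈ s, f k E) = ∑ k ∈ s, expect p (f k) := by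
  simp only [expect, expectOn, Finset.mul_sum]
  exact Finset.sum_comm

lemma expect_mono (hp : ∀ i, p i ∈ Set.Icc (0 : ℝ) 1) {f g : Finset ι → ℝ} (h : ∀ E, f E ≤ g E) :
    expect p f ≤ expect p g := by
  refine Finset.sum_le_sum fun t _ => mul_le_mul_of_nonneg_left (h t) ?_
  exact mul_nonneg (Finset.prod_nonneg fun i _ => (hp i).1)
    (Finset.prod_nonneg fun i _ => sub_nonneg.2 (hp i).2)

/-- Outcomes with an impossible element carry no weight. This allows edge families containing sets
of sizes other than 2 and 3 to be ignored. -/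
lemma expect_mono_of_ne_zero (hp : ∀ i, p i ∈ Set.Icc (0 : ℝ) 1) {f g : Finset ι → ℝ}
    (h : ∀ E, (∀ i ∈ E, p i ≠ 0) → f E ≤ g E) : expect p f ≤ expect p g := by
  refine Finset.sum_le_sum fun t _ => ?_
  by_cases ht : ∀ i ∈ t, p i ≠ 0
  · refine mul_le_mul_of_nonneg_left (h t ht) ?_
    exact mul_nonneg (Finset.prod_nonneg fun i _ => (hp i).1)
      (Finset.prod_nonneg fun i _ => sub_nonneg.2 (hp i).2)
  · push Not at ht
    obtain ⟨i, hi, hi0⟩ := ht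
    simp [Finset.prod_eq_zero hi hi0]

/-- The probability that the random set avoids `C`. -/
lemma expect_avoid (C : Finset ι) :
    expect p (fun E => if Disjoint E C then 1 else 0) = ∏ i ∈ C, (1 - p i) := by
  have h1 : (fun E : Finset ι => if Disjoint E C then (1 : ℝ) else 0)
      = fun E => (fun t _ => if t = ∅ then 1 else 0) (E ∩ C) (E \ C) := by
    funext E; simp [Finset.disjoint_iff_inter_eq_empty]
  rw [h1, expect_split C (fun t _ => if t = ∅ then 1 else 0)]
  simp only [expectOn_const]
  simp [expectOn]

/-- The expectation of `φ X` for a binomial random variable `X` with parameters `k` and `q`. -/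
noncomputable def binomExpect (q : ℝ) : ℕ → (ℕ → ℝ) → ℝ
  | 0, φ => φ 0
  | k + 1, φ => q * binomExpect q k (fun j => φ (j + 1)) + (1 - q) * binomExpect q k φ

/-- If the sets `C w` are disjoint and each of them is hit with probability `q`, then the number
of sets that are hit is binomial. -/
lemma expect_card_hit {κ : Type*} [DecidableEq κ] (N : Finset κ) (C : κ → Finset ι) {q : ℝ}
    (hC : ∀ v ∈ N, ∀ w ∈ N, v ≠ w → Disjoint (C v) (C w))
    (hq : ∀ w ∈ N, ∏ i ∈ C w, (1 - p i) = 1 - q) (φ : ℕ → ℝ) :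
    expect p (fun E => φ (N.filter (fun w => ¬ Disjoint E (C w))).card)
      = binomExpect q N.card φ := by
  induction N using Finset.induction_on generalizing φ with
  | empty => simp [binomExpect]
  | insert a N ha ih =>
    have hdisj : ∀ w ∈ N, Disjoint (C w) (C a) := fun w hw =>
      hC w (by simp [hw]) a (by simp) (fun h => ha (h ▸ hw))
    -- Reveal only whether `C a` is hit; the other sets are disjoint from it, so their count can be
    -- resampled.
    have key := expect_resample (p := p) (C a) (fun E => decide (Disjoint E (C a)))
      (fun b E => φ ((N.filter (fun w => ¬ Disjoint E (C w))).card + if b then 0 else 1))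
      (fun E => by
        congr 1; simp only [Finset.disjoint_iff_inter_eq_empty, Finset.inter_assoc,
          Finset.inter_self])
      (fun _ E => by
        congr 3
        refine Finset.filter_congr fun w hw => ?_
        have := hdisj w hw
        simp only [Finset.disjoint_left, Finset.mem_sdiff] at this ⊢
        grind)
    have hl : (fun E => φ ((insert a N).filter (fun w => ¬ Disjoint E (C w))).card)
        = fun E => φ ((N.filter (fun w => ¬ Disjoint E (C w))).card
          + if decide (Disjoint E (C a)) then 0 else 1) := by
      funext E
      by_cases h : Disjoint E (C a)
      · simp [Finset.filter_insert, h]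
      · rw [Finset.filter_insert, if_pos h, Finset.card_insert_of_notMem (by simp [ha])]
        simp [h]
    rw [hl, key, Finset.card_insert_of_notMem ha, binomExpect]
    have ih' := ih (fun v hv w hw => hC v (by simp [hv]) w (by simp [hw]))
      (fun w hw => hq w (by simp [hw]))
    rw [← ih', ← ih']
    have h2 : ∀ A B : ℝ, expect p (fun E => if Disjoint E (C a) then B else A)
        = q * A + (1 - q) * B := by
      intro A B
      have : (fun E => if Disjoint E (C a) then B else A)
          = fun E => A + (if Disjoint E (C a) then 1 else 0) * (B - A) := by
        funext E; split_ifs <;> ring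
      rw [this, expect_add, expect_mul_const, expect_avoid, expect_const, hq a (by simp)]
      ring
    rw [← h2]
    congr 1
    funext E
    by_cases h : Disjoint E (C a) <;> simp [h]

end RandomSet

/-! ### Binomial expectations and a lower bound for the upper tail -/

section Binomial

variable {q : ℝ}

lemma binomExpect_mono (h0 : 0 ≤ q) (h1 : q ≤ 1) (k : ℕ) {φ ψ : ℕ → ℝ} (h : ∀ j, φ j ≤ ψ j) :
    binomExpect q k φ ≤ binomExpect q k ψ := by
  induction k generalizing φ ψ with
  | zero => exact h 0
  | succ k ih =>
    exact add_le_add (mul_le_mul_of_nonneg_left (ih fun j => h _) h0)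
      (mul_le_mul_of_nonneg_left (ih h) (sub_nonneg.2 h1))

/-- A larger parameter shifts weight to the branch in which the argument of `φ` is increased by one.
-/
lemma binomExpect_mono_param {q' : ℝ} (h0 : 0 ≤ q) (hqq : q ≤ q') (h1 : q' ≤ 1) (k : ℕ) {φ : ℕ → ℝ}
    (hφ : Monotone φ) : binomExpect q k φ ≤ binomExpect q' k φ := by
  induction k generalizing φ with
  | zero => exact le_rfl
  | succ k ih =>
    have hs : Monotone fun j => φ (j + 1) := fun a b h => hφ (by omega)
    have e1 := ih hφ
    have e2 := ih hs
    have e3 := binomExpect_mono h0 (hqq.trans h1) k (φ := φ) (ψ := fun j => φ (j + 1))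
      fun j => hφ (Nat.le_succ j)
    simp only [binomExpect]
    nlinarith [mul_le_mul_of_nonneg_left e2 (h0.trans hqq),
      mul_le_mul_of_nonneg_left e1 (sub_nonneg.2 h1)]

lemma binomExpect_mono_size (h0 : 0 ≤ q) (h1 : q ≤ 1) {k k' : ℕ} (hk : k ≤ k') {φ : ℕ → ℝ}
    (hφ : Monotone φ) : binomExpect q k φ ≤ binomExpect q k' φ := by
  induction k', hk using Nat.le_induction with
  | base => exact le_rfl
  | succ k' _ ih =>
    refine ih.trans ?_
    have e3 := binomExpect_mono h0 h1 k' (φ := φ) (ψ := fun j => φ (j + 1))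
      fun j => hφ (Nat.le_succ j)
    simp only [binomExpect]
    nlinarith [mul_le_mul_of_nonneg_left e3 h0]

lemma binomExpect_const (k : ℕ) (c : ℝ) : binomExpect q k (fun _ => c) = c := by
  induction k with
  | zero => rfl
  | succ k ih => simp only [binomExpect, ih]; ring

/-- The moment generating function; the factor `c` absorbs exp θ in the induction. -/
lemma binomExpect_exp (k : ℕ) (c θ : ℝ) :
    binomExpect q k (fun j => c * Real.exp (θ * j)) = c * (1 + q * (Real.exp θ - 1)) ^ k := by
  induction k generalizing c with
  | zero => simp [binomExpect]
  | succ k ih =>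
    have : (fun j : ℕ => c * Real.exp (θ * (j + 1 : ℕ)))
        = fun j : ℕ => (c * Real.exp θ) * Real.exp (θ * j) := by
      funext j; push_cast; rw [mul_add, Real.exp_add]; ring_nf
    simp only [binomExpect]
    rw [this, ih, ih]; ring

lemma binomExpect_single (k b : ℕ) :
    binomExpect q k (fun j => if j = b then 1 else 0) = k.choose b * q ^ b * (1 - q) ^ (k - b) := by
  induction k generalizing b with
  | zero => cases b <;> simp [binomExpect]
  | succ k ih =>
    simp only [binomExpect]
    rw [ih]
    cases b with
    | zero => simp [binomExpect_const, pow_succ]; ring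
    | succ b =>
      simp only [Nat.add_right_cancel_iff]
      rw [ih, Nat.choose_succ_succ]
      rcases le_or_gt (b + 1) k with h | h
      · obtain ⟨d, rfl⟩ := Nat.exists_eq_add_of_le h
        rw [show b + 1 + d - (b + 1) = d by omega, show b + 1 + d - b = d + 1 by omega,
          show b + 1 + d + 1 - (b + 1) = d + 1 by omega]
        push_cast; ring
      · rw [Nat.choose_eq_zero_of_lt h]
        rw [show k + 1 - (b + 1) = k - b by omega]
        push_cast; ring

/-- The probability that a binomial random variable with parameters `k` and `q` is at least `b`. -/
noncomputable def binomTail (q : ℝ) (k b : ℕ) : ℝ :=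
  binomExpect q k (fun j => if b ≤ j then 1 else 0)

lemma monotone_ite_le (b : ℕ) : Monotone fun j : ℕ => if b ≤ j then (1 : ℝ) else 0 := by
  intro i j h
  simp only
  split_ifs <;> first | omega | norm_num

lemma binomTail_le_one (h0 : 0 ≤ q) (h1 : q ≤ 1) (k b : ℕ) : binomTail q k b ≤ 1 := by
  refine (binomExpect_mono h0 h1 k (ψ := fun _ => 1) fun j => ?_).trans (binomExpect_const k 1).le
  split_ifs <;> norm_num

lemma binomTail_nonneg (h0 : 0 ≤ q) (h1 : q ≤ 1) (k b : ℕ) : 0 ≤ binomTail q k b := by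
  refine (binomExpect_const k 0).ge.trans (binomExpect_mono h0 h1 k fun j => ?_)
  split_ifs <;> norm_num

/-- A weak Stirling bound. The induction step amounts to (b/(b+1))^(b+1) ≤ 1/e. -/
lemma factorial_mul_exp_le {b : ℕ} (hb : 1 ≤ b) :
    (b.factorial : ℝ) * Real.exp b ≤ Real.exp 1 * b * (b : ℝ) ^ b := by
  induction b, hb using Nat.le_induction with
  | base => simp
  | succ b hb ih =>
    have hb0 : (0 : ℝ) < b := by exact_mod_cast hb
    have h1 : Real.exp 1 * (b : ℝ) ^ (b + 1) ≤ ((b + 1 : ℕ) : ℝ) ^ (b + 1) := by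
      have h2 : (b : ℝ) / (b + 1) ≤ Real.exp (-(1 / (b + 1 : ℝ))) := by
        have := Real.add_one_le_exp (-(1 / (b + 1 : ℝ)))
        refine le_trans (le_of_eq ?_) this
        field_simp; ring
      have h3 : ((b : ℝ) / (b + 1)) ^ (b + 1) ≤ Real.exp (-1) := by
        refine (pow_le_pow_left₀ (by positivity) h2 _).trans (le_of_eq ?_)
        rw [← Real.exp_nat_mul]; congr 1; push_cast; field_simp
      rw [div_pow, div_le_iff₀ (by positivity)] at h3
      calc Real.exp 1 * (b : ℝ) ^ (b + 1)
          ≤ Real.exp 1 * (Real.exp (-1) * ((b : ℝ) + 1) ^ (b + 1)) := by gcongr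
        _ = _ := by rw [← mul_assoc, ← Real.exp_add]; simp
    rw [Nat.factorial_succ]
    push_cast at h1 ⊢
    rw [Real.exp_add]
    calc ((b : ℝ) + 1) * b.factorial * (Real.exp b * Real.exp 1)
        = (b + 1) * Real.exp 1 * (b.factorial * Real.exp b) := by ring
      _ ≤ (b + 1) * Real.exp 1 * (Real.exp 1 * b * (b : ℝ) ^ b) := by gcongr
      _ = Real.exp 1 * (b + 1) * (Real.exp 1 * (b : ℝ) ^ (b + 1)) := by ring
      _ ≤ Real.exp 1 * (b + 1) * (((b : ℝ) + 1) ^ (b + 1)) := by gcongr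

/-- A lower bound for the upper tail of a binomial random variable with mean at least `x * b`,
with the rate function `1 - x + log x` of the Poisson distribution. -/
lemma le_binomTail {N b : ℕ} {x : ℝ} (h1 : q ≤ 1) (hb : 1 ≤ b) (hN : 2 * b ^ 2 ≤ N)
    (hx0 : 0 < x) (hx1 : x ≤ 1) (hx : x * b ≤ N * q) :
    Real.exp (b * (1 - x + Real.log x)) / (4 * Real.exp 1 * b) ≤ binomTail q N b := by
  have hb0 : (1 : ℝ) ≤ b := by exact_mod_cast hb
  have hNr : 2 * (b : ℝ) ^ 2 ≤ N := by exact_mod_cast hN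
  have hN0 : (0 : ℝ) < N := by nlinarith
  have hbN : b ≤ N := by nlinarith
  set μ := x * b with hμ
  have hμ0 : 0 < μ := by positivity
  have hμb : μ ≤ b := by nlinarith
  -- The parameter is lowered so that the mean is exactly μ = x b. The tail is then bounded below by
  -- the single probability of the value b, which is compared with the Poisson weight e^(-μ) μ^b /
  -- b!.
  set q₀ := μ / N with hq₀
  have hq₀0 : 0 < q₀ := by positivity
  have hq₀q : q₀ ≤ q := by rw [hq₀, div_le_iff₀ hN0]; linarith
  have hq₀1 : q₀ ≤ 1 := hq₀q.trans h1
  have step1 : (N.choose b : ℝ) * q₀ ^ b * (1 - q₀) ^ (N - b) ≤ binomTail q N b := by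
    rw [← binomExpect_single]
    refine (binomExpect_mono hq₀0.le hq₀1 N (ψ := fun j => if b ≤ j then 1 else 0)
      fun j => ?_).trans (binomExpect_mono_param hq₀0.le hq₀q h1 N (monotone_ite_le b))
    split_ifs <;> first | omega | norm_num
  refine le_trans ?_ step1
  have hfac : (0 : ℝ) < b.factorial := by exact_mod_cast Nat.factorial_pos b
  have hchoose : ((N : ℝ) - b) ^ b / b.factorial ≤ N.choose b := by
    rw [div_le_iff₀ hfac]
    have h := Nat.pow_sub_le_descFactorial N b
    rw [Nat.descFactorial_eq_factorial_mul_choose] at h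
    have h' : (((N + 1 - b : ℕ) : ℝ)) ^ b ≤ b.factorial * N.choose b := by exact_mod_cast h
    rw [mul_comm]
    refine le_trans (pow_le_pow_left₀ (by nlinarith) ?_ _) h'
    rw [Nat.cast_sub (by omega)]; push_cast; linarith
  -- Bernoulli's inequality with b²/N ≤ 1/2.
  have hA : (1 : ℝ) / 2 ≤ (1 - b / N) ^ b := by
    have h2 : (b : ℝ) / N ≤ 1 := by rw [div_le_one hN0]; exact_mod_cast hbN
    have := one_add_mul_le_pow (a := -((b : ℝ) / N)) (by linarith) b
    have h3 : (b : ℝ) * (b / N) ≤ 1 / 2 := by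
      rw [← mul_div_assoc, div_le_iff₀ hN0]; nlinarith
    rw [← sub_eq_add_neg] at this
    linarith
  -- Since (1 + q₀)^N ≤ e^μ, it suffices that (1 - q₀²)^N ≥ 1/2, again by Bernoulli's inequality, as
  -- N q₀² = μ²/N ≤ b²/N.
  have hB : Real.exp (-μ) / 2 ≤ (1 - q₀) ^ N := by
    have h2 : Real.exp (-μ) * ((1 - q₀) * (1 + q₀)) ^ N ≤ (1 - q₀) ^ N := by
      have h4 : (1 + q₀) ^ N ≤ Real.exp μ := by
        refine (pow_le_pow_left₀ (by positivity)
          ((add_comm _ _).trans_le (Real.add_one_le_exp q₀)) N).trans (le_of_eq ?_)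
        rw [← Real.exp_nat_mul, hq₀]; congr 1; field_simp
      have h5 : (0 : ℝ) ≤ (1 - q₀) ^ N := pow_nonneg (sub_nonneg.2 hq₀1) _
      rw [mul_pow]
      calc Real.exp (-μ) * ((1 - q₀) ^ N * (1 + q₀) ^ N)
          ≤ Real.exp (-μ) * ((1 - q₀) ^ N * Real.exp μ) := by gcongr
        _ = (1 - q₀) ^ N * (Real.exp (-μ) * Real.exp μ) := by ring
        _ = _ := by rw [← Real.exp_add]; simp
    have h6 : 1 / 2 ≤ ((1 - q₀) * (1 + q₀)) ^ N := by
      have := one_add_mul_le_pow (a := -(q₀ ^ 2)) (by nlinarith) N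
      have h7 : (N : ℝ) * q₀ ^ 2 ≤ 1 / 2 := by
        rw [hq₀, div_pow, ← mul_div_assoc, div_le_iff₀ (by positivity)]
        have : μ ^ 2 ≤ (b : ℝ) ^ 2 := pow_le_pow_left₀ hμ0.le hμb 2
        nlinarith
      rw [show (1 - q₀) * (1 + q₀) = 1 + -(q₀ ^ 2) by ring]
      linarith
    calc Real.exp (-μ) / 2 = Real.exp (-μ) * (1 / 2) := by ring
      _ ≤ _ := mul_le_mul_of_nonneg_left h6 (Real.exp_pos _).le
      _ ≤ _ := h2
  have hC : (1 - q₀) ^ N ≤ (1 - q₀) ^ (N - b) :=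
    pow_le_pow_of_le_one (sub_nonneg.2 hq₀1) (by linarith) (Nat.sub_le _ _)
  have hpow : ((N : ℝ) - b) ^ b * q₀ ^ b = (1 - b / N) ^ b * μ ^ b := by
    rw [← mul_pow, ← mul_pow, hq₀]; congr 1; field_simp
  have hD : Real.exp (b * (1 - x + Real.log x)) / (4 * Real.exp 1 * b)
      ≤ μ ^ b / b.factorial * (Real.exp (-μ) / 4) := by
    have hf := factorial_mul_exp_le hb
    have e1 : Real.exp (b * (1 - x + Real.log x)) = Real.exp b * Real.exp (-μ) * x ^ b := by
      rw [← Real.exp_log hx0, ← Real.exp_nat_mul, Real.exp_log hx0, ← Real.exp_add, ← Real.exp_add]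
      congr 1; rw [hμ]; ring
    rw [e1, div_mul_div_comm, div_le_div_iff₀ (by positivity) (by positivity), hμ, mul_pow]
    calc Real.exp b * Real.exp (-(x * b)) * x ^ b * (b.factorial * 4)
        = (b.factorial * Real.exp b) * (4 * Real.exp (-(x * b)) * x ^ b) := by ring
      _ ≤ (Real.exp 1 * b * (b : ℝ) ^ b) * (4 * Real.exp (-(x * b)) * x ^ b) := by gcongr
      _ = _ := by ring
  calc _ ≤ μ ^ b / b.factorial * (Real.exp (-μ) / 4) := hD
    _ = (1 / 2) * μ ^ b / b.factorial * (Real.exp (-μ) / 2) := by ring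
    _ ≤ (1 - b / N) ^ b * μ ^ b / b.factorial * (1 - q₀) ^ (N - b) := by
        have := hB.trans hC
        gcongr
    _ = ((N : ℝ) - b) ^ b / b.factorial * q₀ ^ b * (1 - q₀) ^ (N - b) := by
        rw [← hpow]; ring
    _ ≤ _ := by
        have : (0 : ℝ) ≤ (1 - q₀) ^ (N - b) := pow_nonneg (sub_nonneg.2 hq₀1) _
        gcongr

end Binomial

/-! ### The random hypergraph as a random finite set of edges -/

section Edges

/-- The probability that `e` is an edge, if sets of two vertices are edges with probability `p₂`
and sets of three vertices with probability `p₃`. -/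
def edgeProb {V : Type*} (p₂ p₃ : ℝ) (e : Finset V) : ℝ :=
  if e.card = 2 then p₂ else if e.card = 3 then p₃ else 0

lemma edgeProb_mem_Icc {V : Type*} {p₂ p₃ : ℝ} (h₂ : p₂ ∈ Set.Icc (0 : ℝ) 1)
    (h₃ : p₃ ∈ Set.Icc (0 : ℝ) 1) (e : Finset V) : edgeProb p₂ p₃ e ∈ Set.Icc (0 : ℝ) 1 := by
  unfold edgeProb; split_ifs <;> first | assumption | simp

/-- A finite set of finite edges as a set of sets. -/
def edgeSetOf {V : Type*} (E : Finset (Finset V)) : Set (Set V) :=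
  (fun e : Finset V => (e : Set V)) '' E

/-- The measure is concentrated on families of sets from `u`, where its weights are those of
`expectOn`. -/
lemma sum_setBernoulli_mul {V : Type*} [Fintype V] [DecidableEq V] (u : Finset (Finset V))
    (p : unitInterval) (π : Finset V → ℝ) (hπ : ∀ e ∈ u, π e = p) (g : Set (Set V) → ℝ) :
    ∑ a : Set (Set V), (setBernoulli (edgeSetOf u) p).real {a} * g a
      = expectOn π u (fun t => g (edgeSetOf t)) := by
  classical
  have hinj : Function.Injective (edgeSetOf (V := V)) :=
    Set.image_injective.2 Finset.coe_injective |>.comp Finset.coe_injective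
  rw [expectOn, ← Finset.sum_subset (Finset.subset_univ (u.powerset.image edgeSetOf)),
    Finset.sum_image hinj.injOn]
  · refine Finset.sum_congr rfl fun t ht => ?_
    rw [Finset.mem_powerset] at ht
    have hinj' : Function.Injective (fun e : Finset V => (e : Set V)) := Finset.coe_injective
    rw [edgeSetOf, edgeSetOf, setBernoulli_real_singleton _ (Set.image_mono (by exact_mod_cast ht)) (Set.toFinite _),
      Finset.prod_congr (g := fun _ => (p : ℝ)) rfl fun e he => hπ e (ht he),
      Finset.prod_congr (s₁ := u \ t) (g := fun _ => 1 - (p : ℝ)) rfl fun e he => by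
        rw [hπ e (Finset.sdiff_subset he)]]
    rw [Finset.prod_const, Finset.prod_const, ← Set.image_sdiff hinj',
      Set.ncard_image_of_injective _ hinj', Set.ncard_image_of_injective _ hinj',
      ← Finset.coe_sdiff, Set.ncard_coe_finset, Set.ncard_coe_finset]
  · intro a _ ha
    have : ¬ a ⊆ edgeSetOf u := by
      intro h
      obtain ⟨t, ht, rfl⟩ := Set.subset_image_iff.1 h
      apply ha
      rw [Finset.mem_image]
      refine ⟨t.toFinset, ?_, by simp [edgeSetOf]⟩
      rw [Finset.mem_powerset]
      intro x hx
      exact ht (by simpa using hx)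
    simp [measureReal_def, setBernoulli_singleton_of_not_subset p this]

/-- Passes from the product measure to a finite sum over one random family. The 2-sets and the
3-sets are disjoint index sets, and all other sets have probability zero. -/
lemma measureReal_randomEdges (n : ℕ) (p₂ p₃ : unitInterval) (P : Set (Set (Fin n)) → Prop)
    [DecidablePred P] :
    (randomEdges n p₂ p₃).real {ω | P (ω.1 ∪ ω.2)}
      = expect (edgeProb (p₂ : ℝ) p₃) (fun E => if P (edgeSetOf E) then 1 else 0) := by
  classical
  set u₂ : Finset (Finset (Fin n)) := Finset.univ.filter (fun e => e.card = 2) with hu₂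
  set u₃ : Finset (Finset (Fin n)) := Finset.univ.filter (fun e => e.card = 3) with hu₃
  have e₂ : {e : Set (Fin n) | e.ncard = 2} = edgeSetOf u₂ := by
    ext e
    simp only [edgeSetOf, hu₂, Set.mem_image, Set.mem_ofPred_eq, Finset.coe_filter, Finset.mem_univ,
      true_and]
    refine ⟨fun h => ⟨e.toFinset, ?_, by simp⟩, ?_⟩
    · rw [← Set.ncard_eq_toFinset_card', h]
    · rintro ⟨s, hs, rfl⟩; rwa [Set.ncard_coe_finset]
  have e₃ : {e : Set (Fin n) | e.ncard = 3} = edgeSetOf u₃ := by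
    ext e
    simp only [edgeSetOf, hu₃, Set.mem_image, Set.mem_ofPred_eq, Finset.coe_filter, Finset.mem_univ,
      true_and]
    refine ⟨fun h => ⟨e.toFinset, ?_, by simp⟩, ?_⟩
    · rw [← Set.ncard_eq_toFinset_card', h]
    · rintro ⟨s, hs, rfl⟩; rwa [Set.ncard_coe_finset]
  have hprod : ∀ a b : Set (Set (Fin n)), (randomEdges n p₂ p₃).real {(a, b)}
      = (setBernoulli (edgeSetOf u₂) p₂).real {a} * (setBernoulli (edgeSetOf u₃) p₃).real {b} := by
    intro a b
    rw [randomEdges, ← Set.singleton_prod_singleton, measureReal_prod_prod, e₂, e₃]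
  have hlhs : (randomEdges n p₂ p₃).real {ω | P (ω.1 ∪ ω.2)}
      = ∑ a : Set (Set (Fin n)), (setBernoulli (edgeSetOf u₂) p₂).real {a} *
          ∑ b : Set (Set (Fin n)), (setBernoulli (edgeSetOf u₃) p₃).real {b} *
            (if P (a ∪ b) then 1 else 0) := by
    have : IsProbabilityMeasure (randomEdges n p₂ p₃) := by unfold randomEdges; infer_instance
    have h1 : {ω : Set (Set (Fin n)) × Set (Set (Fin n)) | P (ω.1 ∪ ω.2)}
        = ((Finset.univ.filter fun ω : Set (Set (Fin n)) × Set (Set (Fin n)) => P (ω.1 ∪ ω.2) :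
            Finset _) : Set (Set (Set (Fin n)) × Set (Set (Fin n)))) := by ext; simp
    rw [h1, ← sum_measureReal_singleton, Finset.sum_filter, Fintype.sum_prod_type]
    refine Finset.sum_congr rfl fun a _ => ?_
    rw [Finset.mul_sum]
    refine Finset.sum_congr rfl fun b _ => ?_
    rw [hprod]
    split_ifs <;> simp
  rw [hlhs]
  simp_rw [sum_setBernoulli_mul u₃ p₃ (edgeProb (p₂ : ℝ) p₃) (fun e he => by
    rw [hu₃, Finset.mem_filter] at he; simp [edgeProb, he.2])]
  rw [sum_setBernoulli_mul u₂ p₂ (edgeProb (p₂ : ℝ) p₃) (fun e he => by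
    rw [hu₂, Finset.mem_filter] at he; simp [edgeProb, he.2]) (fun a => expectOn _ u₃ _)]
  have hun : (Finset.univ : Finset (Finset (Fin n))) = u₂ ∪ (u₃ ∪ (u₂ ∪ u₃)ᶜ) := by
    rw [← Finset.union_assoc, Finset.union_compl]
  rw [expect, hun, expectOn_union, expectOn_congr]
  · intro t ht
    rw [expectOn_union (disjoint_compl_right.mono_left Finset.subset_union_right)]
    refine expectOn_congr fun t' ht' => ?_
    rw [expectOn_of_eq_zero]
    · rw [Finset.union_empty]
      simp only [edgeSetOf, Finset.coe_union, Set.image_union]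
      congr
    · intro e he
      simp only [hu₂, hu₃, Finset.mem_compl, Finset.mem_union, Finset.mem_filter, Finset.mem_univ,
        true_and, not_or] at he
      simp [edgeProb, he.1, he.2]
  · rw [Finset.disjoint_left]
    intro e he
    simp only [hu₂, hu₃, Finset.mem_compl, Finset.mem_union, Finset.mem_filter, Finset.mem_univ,
      true_and] at he ⊢
    simp [he]

end Edges

/-! ### Exploring a hypergraph -/

section Exploration

variable {V : Type*} [DecidableEq V]

/-- The sets of two or three vertices that contain `w`, a vertex of `L`, and possibly a vertex
of `D`. -/
def links (D L : Finset V) (w : V) : Finset (Finset V) :=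
  L.image (fun x => {x, w}) ∪ (L ×ˢ D).image (fun z => {z.1, z.2, w})

/-- The vertices of `N` that are linked to `L`, possibly with the help of `D`, by an edge in `E`. -/
def hit (E : Finset (Finset V)) (N D L : Finset V) : Finset V :=
  N.filter fun w => ¬ Disjoint E (links D L w)

/-- The probability that a vertex is linked to a set of `l` vertices, possibly with the help of a
set of `d` vertices. -/
def linkProb (p₂ p₃ : ℝ) (d l : ℕ) : ℝ := 1 - (1 - p₂) ^ l * (1 - p₃) ^ (l * d)

lemma linkProb_mem_Icc {p₂ p₃ : ℝ} (h₂ : p₂ ∈ Set.Icc (0 : ℝ) 1) (h₃ : p₃ ∈ Set.Icc (0 : ℝ) 1)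
    (d l : ℕ) : linkProb p₂ p₃ d l ∈ Set.Icc (0 : ℝ) 1 := by
  have a2 := pow_le_one₀ (n := l) (sub_nonneg.2 h₂.2) (by linarith [h₂.1])
  have a3 := pow_le_one₀ (n := l * d) (sub_nonneg.2 h₃.2) (by linarith [h₃.1])
  have b2 := pow_nonneg (sub_nonneg.2 h₂.2) l
  have b3 := pow_nonneg (sub_nonneg.2 h₃.2) (l * d)
  have := mul_nonneg b2 b3
  have := mul_le_one₀ a2 b3 a3
  unfold linkProb
  constructor <;> linarith

variable {D L N R : Finset V} {w : V} {E : Finset (Finset V)}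

/-- There are |L| pairs and |L||D| triples in `links D L w`, all distinct because `D`, `L` and `{w}`
are disjoint. -/
lemma prod_links {p₂ p₃ : ℝ} (hDL : Disjoint D L) (hD : w ∉ D) (hL : w ∉ L) :
    ∏ e ∈ links D L w, (1 - edgeProb p₂ p₃ e) = 1 - linkProb p₂ p₃ D.card L.card := by
  have h2 : ∀ x ∈ L, ({x, w} : Finset V).card = 2 := fun x hx =>
    Finset.card_pair fun h => hL (h ▸ hx)
  have h3 : ∀ z ∈ L ×ˢ D, ({z.1, z.2, w} : Finset V).card = 3 := by
    rintro ⟨x, d⟩ hz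
    rw [Finset.mem_product] at hz
    refine Finset.card_eq_three.2 ⟨x, d, w, ?_, ?_, ?_, rfl⟩
    · exact fun h => Finset.disjoint_left.1 hDL hz.2 (h ▸ hz.1)
    · exact fun h => hL (h ▸ hz.1)
    · exact fun h => hD (h ▸ hz.2)
  rw [links, Finset.prod_union, Finset.prod_image, Finset.prod_image,
    Finset.prod_congr rfl fun x hx => by rw [edgeProb, if_pos (h2 x hx)],
    Finset.prod_congr (s₁ := L ×ˢ D) (g := fun _ => 1 - p₃) rfl fun z hz => by
      rw [edgeProb, if_neg (by rw [h3 z hz]; norm_num), if_pos (h3 z hz)]]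
  · simp [linkProb]
  · rintro ⟨x, d⟩ hz ⟨x', d'⟩ hz' h
    simp only [Finset.coe_product, Set.mem_prod, Finset.mem_coe] at hz hz'
    simp only at h
    have hx : x ∈ ({x', d', w} : Finset V) := by rw [← h]; simp
    have hd : d ∈ ({x', d', w} : Finset V) := by rw [← h]; simp
    have := Finset.disjoint_left.1 hDL
    simp only [Finset.mem_insert, Finset.mem_singleton] at hx hd
    grind
  · intro x hx x' hx' h
    simp only at h
    have h1 : x ∈ ({x', w} : Finset V) := by rw [← h]; simp
    simp only [Finset.mem_insert, Finset.mem_singleton] at h1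
    rcases h1 with h1 | h1
    · exact h1
    · exact absurd (h1 ▸ hx) hL
  · rw [Finset.disjoint_left]
    intro e he he'
    obtain ⟨x, hx, rfl⟩ := Finset.mem_image.1 he
    obtain ⟨z, hz, hzx⟩ := Finset.mem_image.1 he'
    have := h3 z hz
    rw [hzx, h2 x hx] at this
    omega

lemma mem_of_mem_links {e : Finset V} (he : e ∈ links D L w) :
    w ∈ e ∧ (∃ x ∈ L, x ∈ e) ∧ e ⊆ insert w (D ∪ L) := by
  rw [links, Finset.mem_union, Finset.mem_image, Finset.mem_image] at he
  rcases he with ⟨x, hx, rfl⟩ | ⟨⟨x, d⟩, hz, rfl⟩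
  · refine ⟨by simp, ⟨x, hx, by simp⟩, ?_⟩
    intro y; simp only [Finset.mem_insert, Finset.mem_singleton, Finset.mem_union]; grind
  · rw [Finset.mem_product] at hz
    refine ⟨by simp, ⟨x, hz.1, by simp⟩, ?_⟩
    intro y; simp only [Finset.mem_insert, Finset.mem_singleton, Finset.mem_union]; grind

/-- A link of `w` has no vertex other than `w` outside `D ∪ L`, so it cannot also contain `w'`. -/
lemma disjoint_links {w' : V} (hw : w ≠ w') (h : w' ∉ D ∪ L) :
    Disjoint (links D L w) (links D L w') := by
  rw [Finset.disjoint_left]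
  intro e he he'
  have h1 := (mem_of_mem_links he).2.2 (mem_of_mem_links he').1
  rcases Finset.mem_insert.1 h1 with h1 | h1
  · exact hw h1.symm
  · exact h h1

lemma hit_subset : hit E N D L ⊆ N := Finset.filter_subset _ _

variable [Fintype V]

/-- The sets of vertices with at most one element outside of `R`. -/
def nearlyInside (R : Finset V) : Finset (Finset V) :=
  Finset.univ.filter fun e => (e \ R).card ≤ 1

/-- With the next lemma, this is the reason for `nearlyInside`: current queries stay within it, and
later ones, having both `w` and a vertex of the new layer outside the old reached set, avoid it. -/
lemma links_subset_nearlyInside : links D L w ⊆ nearlyInside (D ∪ L) := by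
  intro e he
  rw [nearlyInside, Finset.mem_filter]
  refine ⟨Finset.mem_univ _, ?_⟩
  refine (Finset.card_le_card (t := {w}) ?_).trans (by simp)
  intro x hx
  rw [Finset.mem_sdiff] at hx
  have := (mem_of_mem_links he).2.2 hx.1
  rw [Finset.mem_insert] at this
  exact Finset.mem_singleton.2 (this.resolve_right hx.2)

lemma disjoint_links_nearlyInside (hL : Disjoint R L) (hw : w ∉ R) (hwL : w ∉ L) :
    Disjoint (links D L w) (nearlyInside R) := by
  rw [Finset.disjoint_left]
  intro e he he'
  obtain ⟨h1, ⟨x, hx, hxe⟩, -⟩ := mem_of_mem_links he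
  rw [nearlyInside, Finset.mem_filter, Finset.card_le_one] at he'
  have := he'.2 w (by simp [h1, hw]) x (by simp [hxe, Finset.disjoint_right.1 hL hx])
  exact hwL (this ▸ hx)

lemma hit_inter_nearlyInside : hit (E ∩ nearlyInside (D ∪ L)) N D L = hit E N D L := by
  refine Finset.filter_congr fun w _ => ?_
  have := links_subset_nearlyInside (D := D) (L := L) (w := w)
  simp only [Finset.disjoint_left, Finset.mem_inter]
  grind

lemma hit_sdiff_nearlyInside (hL : Disjoint R L) (hN : Disjoint R N) (hNL : Disjoint L N) :
    hit (E \ nearlyInside R) N D L = hit E N D L := by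
  refine Finset.filter_congr fun w hw => ?_
  have := disjoint_links_nearlyInside (D := D) hL (Finset.disjoint_right.1 hN hw)
    (Finset.disjoint_right.1 hNL hw)
  simp only [Finset.disjoint_left, Finset.mem_sdiff] at this ⊢
  grind

lemma expect_card_hit_links {p₂ p₃ : ℝ} (hDL : Disjoint D L) (hN : Disjoint (D ∪ L) N)
    (φ : ℕ → ℝ) :
    expect (edgeProb p₂ p₃) (fun E => φ (hit E N D L).card)
      = binomExpect (linkProb p₂ p₃ D.card L.card) N.card φ := by
  refine expect_card_hit N (links D L) (fun v _ w hw hvw => ?_) (fun w hw => ?_) φ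
  · exact disjoint_links hvw (Finset.disjoint_right.1 hN hw)
  · have := Finset.disjoint_right.1 hN hw
    rw [Finset.mem_union, not_or] at this
    exact prod_links hDL this.1 this.2

/-! ### Exploring one vertex at a time -/

/-- The exploration of a hypergraph with explored vertices `D` and active vertices `A`: in each
step, explore an active vertex `v` and activate the vertices that are linked to `v`, possibly with
the help of `D`. The value is `1` if there are still active vertices after `k` steps, and `0`
otherwise. -/
noncomputable def survive : ℕ → Finset V → Finset V → Finset (Finset V) → ℝ
  | 0, _, A, _ => if A.Nonempty then 1 else 0
  | k + 1, D, A, E =>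
    if h : A.Nonempty then
      survive k (insert h.choose D) (A.erase h.choose ∪ hit E (Finset.univ \ (D ∪ A)) D {h.choose}) E
    else 0

lemma survive_of_not_nonempty {A : Finset V} (h : ¬ A.Nonempty) (k : ℕ) : survive k D A E = 0 := by
  cases k <;> simp [survive, h]

lemma survive_nonneg (k : ℕ) (D A : Finset V) : 0 ≤ survive k D A E := by
  induction k generalizing D A with
  | zero => simp only [survive]; split_ifs <;> norm_num
  | succ k ih =>
    simp only [survive]; split_ifs
    · exact ih _ _
    · rfl

lemma disjoint_survive_step {A W : Finset V} {v : V} (hDA : Disjoint D A)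
    (hW : W ⊆ Finset.univ \ (D ∪ A)) (hv : v ∈ A) : Disjoint (insert v D) (A.erase v ∪ W) := by
  rw [Finset.disjoint_left] at hDA ⊢
  intro x hx hx'
  rw [Finset.mem_insert] at hx
  rw [Finset.mem_union, Finset.mem_erase] at hx'
  rcases hx' with hx' | hx'
  · grind
  · have := hW hx'
    simp only [Finset.mem_sdiff, Finset.mem_union] at this
    grind

/-- All further queries concern edges that contain an active vertex and an unused one, both outside
`R`; hence the future of the exploration does not see the edges already revealed. -/
lemma survive_sdiff_nearlyInside (k : ℕ) {D A : Finset V} (hR : R ⊆ D) (hDA : Disjoint D A) :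
    survive k D A (E \ nearlyInside R) = survive k D A E := by
  induction k generalizing D A with
  | zero => rfl
  | succ k ih =>
    simp only [survive]
    split_ifs with h
    · have hv := h.choose_spec
      rw [hit_sdiff_nearlyInside, ih (hR.trans (Finset.subset_insert _ _))
        (disjoint_survive_step hDA hit_subset hv)]
      · exact Finset.disjoint_singleton_right.2 fun h' => Finset.disjoint_right.1 hDA hv (hR h')
      · exact (Finset.disjoint_sdiff).mono_left (hR.trans Finset.subset_union_left)
      · exact (Finset.disjoint_sdiff).mono_left
          (Finset.singleton_subset_iff.2 (Finset.mem_union_right _ hv))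
    · rfl

/-- An upper bound for the probability that the exploration survives for `k` steps, by
exponential tilting. -/
lemma expect_survive_le {p₂ p₃ : ℝ} (h₂ : p₂ ∈ Set.Icc (0 : ℝ) 1) (h₃ : p₃ ∈ Set.Icc (0 : ℝ) 1)
    {θ c : ℕ → ℝ} (hθ : Antitone θ) (hθ0 : ∀ j, 0 ≤ θ j)
    (hc : ∀ j, Real.exp (-θ j) * (1 + linkProb p₂ p₃ j 1 * (Real.exp (θ j) - 1)) ^ Fintype.card V
      ≤ c j) (k : ℕ) {D A : Finset V} (hDA : Disjoint D A) :
    expect (edgeProb p₂ p₃) (survive k D A)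
      ≤ Real.exp (θ D.card * (A.card - 1)) * ∏ i ∈ Finset.range k, c (D.card + i) := by
  have hq : ∀ j, 0 ≤ linkProb p₂ p₃ j 1 * (Real.exp (θ j) - 1) := fun j =>
    mul_nonneg (linkProb_mem_Icc h₂ h₃ j 1).1 (by linarith [Real.add_one_le_exp (θ j), hθ0 j])
  have hc0 : ∀ j, 0 ≤ c j := fun j => le_trans
    (mul_nonneg (Real.exp_pos _).le (pow_nonneg (by linarith [hq j]) _)) (hc j)
  induction k generalizing D A with
  | zero =>
    by_cases h : A.Nonempty
    · have : (1 : ℝ) ≤ A.card := by exact_mod_cast h.card_pos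
      simp only [survive, h, if_true, expect_const, Finset.range_zero, Finset.prod_empty, mul_one]
      exact Real.one_le_exp (mul_nonneg (hθ0 _) (by linarith))
    · simp only [survive, h, if_false, expect_const]
      positivity
  | succ k ih =>
    by_cases h : A.Nonempty
    swap
    · simp only [survive, h, dif_neg, not_false_eq_true, expect_const]
      exact mul_nonneg (Real.exp_pos _).le (Finset.prod_nonneg fun i _ => hc0 _)
    set v := h.choose with hv
    have hvA : v ∈ A := h.choose_spec
    have hvD : v ∉ D := Finset.disjoint_right.1 hDA hvA
    set N := Finset.univ \ (D ∪ A) with hN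
    have hins : insert v D = D ∪ {v} := by rw [Finset.union_comm]; rfl
    have hNv : Disjoint (D ∪ {v}) N := Finset.disjoint_sdiff.mono_left
      (Finset.union_subset_union_right (Finset.singleton_subset_iff.2 hvA))
    have hcard : ∀ W ⊆ N, ((A.erase v ∪ W).card : ℝ) = A.card - 1 + W.card := by
      intro W hW
      rw [Finset.card_union_of_disjoint, Finset.card_erase_of_mem hvA]
      · have := h.card_pos
        push_cast [Nat.cast_sub this]; ring
      · exact (Finset.disjoint_sdiff.mono_left ((Finset.erase_subset _ _).trans
          Finset.subset_union_right)).mono_right hW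
    set Q := ∏ i ∈ Finset.range k, c (D.card + 1 + i) with hQ
    have hQ₀ : 0 ≤ Q := Finset.prod_nonneg fun i _ => hc0 _
    have key := expect_resample (p := edgeProb p₂ p₃) (nearlyInside (D ∪ {v}))
      (fun E => hit E N D {v}) (fun W => survive k (insert v D) (A.erase v ∪ W))
      (fun E => hit_inter_nearlyInside.symm)
      (fun E' E => (survive_sdiff_nearlyInside k hins.ge
        (disjoint_survive_step hDA hit_subset hvA)).symm)
    have h1 : survive (k + 1) D A
        = fun E => survive k (insert v D) (A.erase v ∪ hit E N D {v}) E := by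
      funext E; simp only [survive, dif_pos h]; rfl
    have h2 : ∀ E, expect (edgeProb p₂ p₃) (survive k (insert v D) (A.erase v ∪ hit E N D {v}))
        ≤ (fun j : ℕ => Real.exp (θ D.card * (A.card - 2)) * Q * Real.exp (θ D.card * j))
          (hit E N D {v}).card := by
      intro E
      set W := hit E N D {v}
      have e1 : Real.exp (θ D.card * (A.card - 2)) * Q * Real.exp (θ D.card * W.card)
          = Real.exp (θ D.card * ((A.erase v ∪ W).card - 1)) * Q := by
        rw [hcard W hit_subset, mul_right_comm, ← Real.exp_add]; congr 2; ring
      simp only [e1]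
      -- The induction hypothesis has the tilt of the next step, which is at most the present one.
      -- Replacing it is an upper bound only when the active set has at least one element; an empty
      -- set contributes zero anyway.
      by_cases hA' : (A.erase v ∪ W).Nonempty
      · refine (ih (disjoint_survive_step hDA hit_subset hvA)).trans ?_
        rw [Finset.card_insert_of_notMem hvD]
        refine mul_le_mul_of_nonneg_right (Real.exp_le_exp.2 ?_) hQ₀
        have : (1 : ℝ) ≤ (A.erase v ∪ W).card := by exact_mod_cast hA'.card_pos
        exact mul_le_mul_of_nonneg_right (hθ (Nat.le_succ _)) (by linarith)
      · have : survive k (insert v D) (A.erase v ∪ W) = fun _ => (0 : ℝ) := by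
          funext E; exact survive_of_not_nonempty hA' k
        rw [this, expect_const]
        positivity
    rw [h1, key]
    refine (expect_mono (edgeProb_mem_Icc h₂ h₃) h2).trans ?_
    rw [expect_card_hit_links (Finset.disjoint_singleton_right.2 hvD) hNv
      (fun j : ℕ => Real.exp (θ D.card * (A.card - 2)) * Q * Real.exp (θ D.card * j)), binomExpect_exp,
      Finset.prod_range_succ', Finset.card_singleton]
    -- The number of unused vertices is replaced by that of all vertices, which makes the factor
    -- independent of the history.
    have h3 : (1 + linkProb p₂ p₃ D.card 1 * (Real.exp (θ D.card) - 1)) ^ N.card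
        ≤ (1 + linkProb p₂ p₃ D.card 1 * (Real.exp (θ D.card) - 1)) ^ Fintype.card V :=
      pow_le_pow_right₀ (by linarith [hq D.card]) (Finset.card_le_univ _)
    have h4 := hc D.card
    have e2 : Real.exp (θ D.card * (A.card - 2))
        = Real.exp (θ D.card * (A.card - 1)) * Real.exp (-θ D.card) := by
      rw [← Real.exp_add]; congr 1; ring
    have e3 : ∏ i ∈ Finset.range k, c (D.card + (i + 1)) = Q := by
      refine Finset.prod_congr rfl fun i _ => ?_
      congr 1; ring
    rw [e2, e3, add_zero]
    calc _ = Real.exp (θ D.card * (A.card - 1)) * Q * (Real.exp (-θ D.card) *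
            (1 + linkProb p₂ p₃ D.card 1 * (Real.exp (θ D.card) - 1)) ^ N.card) := by ring
      _ ≤ Real.exp (θ D.card * (A.card - 1)) * Q * c D.card := by
          refine mul_le_mul_of_nonneg_left (le_trans ?_ h4) (by positivity)
          exact mul_le_mul_of_nonneg_left h3 (Real.exp_pos _).le
      _ = _ := by ring

/-- If no proper set of vertices that contains `v₀` is closed, then the exploration survives until
all vertices are explored. -/
lemma survive_eq_one {v₀ : V}
    (hE : ∀ S : Finset V, v₀ ∈ S → S ≠ Finset.univ →
      ∃ e ∈ E, (e.card = 2 ∨ e.card = 3) ∧ ∃ w, e \ S = {w})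
    (k : ℕ) {D A : Finset V} (hv₀ : v₀ ∈ D ∪ A) (hk : D.card + k < Fintype.card V)
    (hA : ∀ e ∈ E, (e.card = 2 ∨ e.card = 3) → ∀ w, e \ D = {w} → w ∈ A) :
    survive k D A E = 1 := by
  -- If nothing were active, `D` would contain `v₀` and be proper, so some edge would leave it by
  -- one vertex, which the invariant puts into `A`. The invariant says that such vertices are always
  -- active.
  have hne : ∀ D A : Finset V, v₀ ∈ D ∪ A → D.card < Fintype.card V →
      (∀ e ∈ E, (e.card = 2 ∨ e.card = 3) → ∀ w, e \ D = {w} → w ∈ A) → A.Nonempty := by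
    intro D A h1 h2 h3
    by_contra h
    rw [Finset.not_nonempty_iff_eq_empty] at h
    subst h
    rw [Finset.union_empty] at h1
    obtain ⟨e, he, he2, w, hw⟩ := hE D h1 (fun h => by simp [h] at h2)
    exact absurd (h3 e he he2 w hw) (by simp)
  induction k generalizing D A with
  | zero => simp only [survive, if_pos (hne D A hv₀ (by omega) hA)]
  | succ k ih =>
    have h := hne D A hv₀ (by omega) hA
    simp only [survive, dif_pos h]
    set v := h.choose
    have hvA : v ∈ A := h.choose_spec
    refine ih ?_ ?_ ?_
    · rw [Finset.mem_union] at hv₀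
      simp only [Finset.mem_union, Finset.mem_insert, Finset.mem_erase]
      grind
    · have := Finset.card_insert_le v D
      omega
    · intro e he he2 w hw
      have hwe : w ∈ e ∧ w ≠ v ∧ w ∉ D := by
        have : w ∈ e \ insert v D := by rw [hw]; simp
        simpa using this
      have hsub : ∀ x ∈ e, x ≠ v → x ∉ D → x = w := by
        intro x hx hxv hxD
        have : x ∈ e \ insert v D := by simp [hx, hxv, hxD]
        rw [hw] at this
        simpa using this
      by_cases hwA : w ∈ A
      · simp [hwA, hwe.2.1]
      rw [Finset.mem_union]
      right
      -- Without `v`, the edge would already have had `w` as its only vertex outside `D`, and `w`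
      -- would be active. So the edge consists of `v`, `w` and possibly a vertex of `D`: it is a
      -- link.
      have hve : v ∈ e := by
        by_contra hve
        refine hwA (hA e he he2 w ?_)
        ext x
        simp only [Finset.mem_sdiff, Finset.mem_singleton]
        constructor
        · rintro ⟨hx, hxD⟩
          exact hsub x hx (fun hxv => hve (hxv ▸ hx)) hxD
        · rintro rfl
          exact ⟨hwe.1, hwe.2.2⟩
      rw [hit, Finset.mem_filter]
      refine ⟨by simp [hwe.2.2, hwA], ?_⟩
      rw [Finset.not_disjoint_iff]
      refine ⟨e, he, ?_⟩
      have hvw : v ≠ w := hwe.2.1.symm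
      have hpair : ({v, w} : Finset V) ⊆ e := by
        intro x; simp only [Finset.mem_insert, Finset.mem_singleton]; grind
      rw [links, Finset.mem_union]
      rcases he2 with he2 | he2
      · left
        rw [Finset.mem_image]
        exact ⟨v, by simp, Finset.eq_of_subset_of_card_le hpair (by
          rw [he2, Finset.card_pair hvw])⟩
      · right
        obtain ⟨d, hd⟩ : ∃ d, d ∈ e \ {v, w} := by
          rw [← Finset.Nonempty, ← Finset.card_pos, Finset.card_sdiff_of_subset hpair,
            Finset.card_pair hvw]
          omega
        simp only [Finset.mem_sdiff, Finset.mem_insert, Finset.mem_singleton, not_or] at hd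
        have hdD : d ∈ D := by
          by_contra hdD
          exact hd.2.2 (hsub d hd.1 hd.2.1 hdD)
        rw [Finset.mem_image]
        refine ⟨(v, d), by simp [hdD], Finset.eq_of_subset_of_card_le ?_ ?_⟩
        · intro x; simp only [Finset.mem_insert, Finset.mem_singleton]; grind
        · rw [he2]
          exact (Finset.card_eq_three.2 ⟨v, d, w, fun h => hd.2.1 h.symm, hvw, hd.2.2, rfl⟩).ge

end Exploration

section Layers

variable {V : Type*} [DecidableEq V]

/-! ### Exploring layers of prescribed sizes -/

/-- Starting from the last layer `L` and the union `D` of the earlier layers, look for further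
layers of sizes `bs` in the hypergraph on `U`: each of them consists of vertices that are linked to
the previous layer, possibly with the help of the earlier ones. The value is `0` in the case of
success; otherwise, it is given by `r`, evaluated at the set of unused vertices. -/
noncomputable def growLayers (r : Finset V → Finset (Finset V) → ℝ) (U : Finset V) :
    List ℕ → Finset V → Finset V → Finset (Finset V) → ℝ
  | [], _, _, _ => 0
  | b :: bs, D, L, E =>
    if h : b ≤ (hit E (U \ (D ∪ L)) D L).card then
      growLayers r U bs (D ∪ L) (Finset.exists_subset_card_eq h).choose E
    else r (U \ (D ∪ L)) E

/-- At most `m` attempts to grow layers of sizes `bs` from a single vertex, where each attempt only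
uses vertices that have not been used before. The value is `0` if one of the attempts is
successful, and `1` otherwise. -/
noncomputable def tryLayers (bs : List ℕ) : ℕ → Finset V → Finset (Finset V) → ℝ
  | 0, _, _ => 1
  | m + 1, U, E =>
    if h : U.Nonempty then growLayers (tryLayers bs m) U bs ∅ {h.choose} E else 1

/-- A lower bound for the probability that an attempt to grow layers of sizes `bs` is successful,
if the last layer has `l` vertices, the earlier ones have `d` vertices, and at least `N` vertices
remain unused. -/
noncomputable def growProb (p₂ p₃ : ℝ) (N : ℕ) : List ℕ → ℕ → ℕ → ℝ
  | [], _, _ => 1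
  | b :: bs, d, l => binomTail (linkProb p₂ p₃ d l) N b * growProb p₂ p₃ N bs (d + l) b

lemma growProb_mem_Icc {p₂ p₃ : ℝ} (h₂ : p₂ ∈ Set.Icc (0 : ℝ) 1) (h₃ : p₃ ∈ Set.Icc (0 : ℝ) 1)
    (N : ℕ) (bs : List ℕ) (d l : ℕ) : growProb p₂ p₃ N bs d l ∈ Set.Icc (0 : ℝ) 1 := by
  induction bs generalizing d l with
  | nil => simp [growProb]
  | cons b bs ih =>
    have h := linkProb_mem_Icc h₂ h₃ d l
    exact ⟨mul_nonneg (binomTail_nonneg h.1 h.2 _ _) (ih _ _).1,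
      mul_le_one₀ (binomTail_le_one h.1 h.2 _ _) (ih _ _).1 (ih _ _).2⟩

variable {D L N R U : Finset V} {E : Finset (Finset V)} {r : Finset V → Finset (Finset V) → ℝ}

lemma growLayers_eq_zero_or_one (hr : ∀ U E, r U E = 0 ∨ r U E = 1) (bs : List ℕ) (D L : Finset V) :
    growLayers r U bs D L E = 0 ∨ growLayers r U bs D L E = 1 := by
  induction bs generalizing D L with
  | nil => simp [growLayers]
  | cons b bs ih =>
    simp only [growLayers]; split_ifs
    · exact ih _ _
    · exact hr _ _

lemma tryLayers_eq_zero_or_one (bs : List ℕ) (m : ℕ) (U : Finset V) (E : Finset (Finset V)) :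
    tryLayers bs m U E = 0 ∨ tryLayers bs m U E = 1 := by
  induction m generalizing U E with
  | zero => simp [tryLayers]
  | succ m ih =>
    simp only [tryLayers]; split_ifs
    · exact growLayers_eq_zero_or_one ih _ _ _
    · simp

section Finite

variable [Fintype V]

lemma growLayers_sdiff_nearlyInside
    (hr : ∀ U', U' ⊆ U → Disjoint R U' → ∀ E, r U' (E \ nearlyInside R) = r U' E)
    (bs : List ℕ) (hL : Disjoint R L) (hU : Disjoint R (U \ (D ∪ L))) :
    growLayers r U bs D L (E \ nearlyInside R) = growLayers r U bs D L E := by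
  induction bs generalizing D L with
  | nil => rfl
  | cons b bs ih =>
    have hhit : hit (E \ nearlyInside R) (U \ (D ∪ L)) D L = hit E (U \ (D ∪ L)) D L :=
      hit_sdiff_nearlyInside hL hU (Finset.disjoint_sdiff.mono_left Finset.subset_union_right)
    simp only [growLayers, hhit]
    split_ifs with h
    · refine ih (hU.mono_right ?_) (hU.mono_right ?_)
      · exact (Finset.exists_subset_card_eq h).choose_spec.1.trans hit_subset
      · exact Finset.sdiff_subset_sdiff subset_rfl Finset.subset_union_left
    · exact hr _ Finset.sdiff_subset hU _

lemma tryLayers_sdiff_nearlyInside (bs : List ℕ) (m : ℕ) (hU : Disjoint R U) :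
    tryLayers bs m U (E \ nearlyInside R) = tryLayers bs m U E := by
  induction m generalizing U E with
  | zero => rfl
  | succ m ih =>
    simp only [tryLayers]
    split_ifs with h
    · refine growLayers_sdiff_nearlyInside (fun U' _ hU' E => ih hU') bs ?_ ?_
      · exact hU.mono_right (Finset.singleton_subset_iff.2 h.choose_spec)
      · exact hU.mono_right Finset.sdiff_subset
    · rfl

/-- Think of `r` as the failure of all later attempts, with probability at most `φ`. Total failure
requires that this attempt fail and then that the later ones fail on fresh edges. The bound on
`U.card` ensures that `u` vertices remain wherever the attempt stops. -/
lemma expect_growLayers_le {p₂ p₃ : ℝ} (h₂ : p₂ ∈ Set.Icc (0 : ℝ) 1) (h₃ : p₃ ∈ Set.Icc (0 : ℝ) 1)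
    {φ : ℝ} (hφ : 0 ≤ φ) {N u : ℕ} (hN : N ≤ u)
    (hr : ∀ R U', Disjoint R U' → ∀ E, r U' (E \ nearlyInside R) = r U' E)
    (hrφ : ∀ U', u ≤ U'.card → expect (edgeProb p₂ p₃) (r U') ≤ φ)
    (bs : List ℕ) (hDL : Disjoint D L) (hU : u + bs.sum + D.card + L.card ≤ U.card) :
    expect (edgeProb p₂ p₃) (growLayers r U bs D L)
      ≤ (1 - growProb p₂ p₃ N bs D.card L.card) * φ := by
  induction bs generalizing D L with
  | nil =>
    have : growLayers r U [] D L = fun _ => (0 : ℝ) := rfl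
    rw [this, expect_const]; simp [growProb]
  | cons b bs ih =>
    rw [List.sum_cons] at hU
    set M := U \ (D ∪ L) with hM
    have hMcard : u ≤ M.card := by
      have := Finset.le_card_sdiff (D ∪ L) U
      rw [Finset.card_union_of_disjoint hDL, ← hM] at this
      omega
    have hMD : Disjoint (D ∪ L) M := Finset.disjoint_sdiff
    -- The revealed set of hit vertices becomes a separate argument, so that the continuation can be
    -- resampled. On failure, only `D ∪ L` is discarded; the vertices just hit remain usable.
    set G : Finset V → Finset (Finset V) → ℝ := fun W E =>
      if h : b ≤ W.card then growLayers r U bs (D ∪ L) (Finset.exists_subset_card_eq h).choose E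
      else r M E with hG
    have hsub : ∀ E, ∀ h : b ≤ (hit E M D L).card,
        Disjoint (D ∪ L) (Finset.exists_subset_card_eq h).choose := fun E h =>
      hMD.mono_right ((Finset.exists_subset_card_eq h).choose_spec.1.trans hit_subset)
    have key := expect_resample (p := edgeProb p₂ p₃) (nearlyInside (D ∪ L))
      (fun E => hit E M D L) G (fun E => hit_inter_nearlyInside.symm)
      (fun E' E => by
        simp only [hG]
        split_ifs with h
        · exact (growLayers_sdiff_nearlyInside (fun U' _ h' => hr _ U' h') bs (hsub E' h)
            (Finset.disjoint_sdiff.mono_left Finset.subset_union_left)).symm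
        · exact (hr _ _ hMD _).symm)
    have h1 : growLayers r U (b :: bs) D L = fun E => G (hit E M D L) E := rfl
    set s := growProb p₂ p₃ N bs (D.card + L.card) b with hs
    have hs0 : 0 ≤ s := (growProb_mem_Icc h₂ h₃ _ _ _ _).1
    have h2 : ∀ E, expect (edgeProb p₂ p₃) (G (hit E M D L))
        ≤ φ - (φ * s) * (fun j : ℕ => if b ≤ j then (1 : ℝ) else 0) (hit E M D L).card := by
      intro E
      simp only [hG]
      by_cases h : b ≤ (hit E M D L).card
      · simp only [h, dif_pos, if_true]
        have hc := (Finset.exists_subset_card_eq h).choose_spec.2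
        refine (ih (hsub E h) ?_).trans ?_
        · rw [hc, Finset.card_union_of_disjoint hDL]; omega
        · rw [hc, Finset.card_union_of_disjoint hDL]
          apply le_of_eq; ring
      · simp only [h, dif_neg, if_false, not_false_eq_true]
        simpa using hrφ M hMcard
    have hq := linkProb_mem_Icc h₂ h₃ D.card L.card
    rw [h1, key]
    refine (expect_mono (edgeProb_mem_Icc h₂ h₃) h2).trans ?_
    rw [expect_sub, expect_const, expect_const_mul,
      expect_card_hit_links hDL hMD (fun j : ℕ => if b ≤ j then (1 : ℝ) else 0)]
    have h3 := binomExpect_mono_size hq.1 hq.2 (hN.trans hMcard) (monotone_ite_le b)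
    have h4 := mul_le_mul_of_nonneg_left h3 (mul_nonneg hφ hs0)
    rw [growProb, binomTail, ← hs]
    linarith

/-- An attempt uses at most 1 + `bs.sum` vertices, so at least `N` remain throughout, and the
failure probabilities multiply. -/
lemma expect_tryLayers_le {p₂ p₃ : ℝ} (h₂ : p₂ ∈ Set.Icc (0 : ℝ) 1) (h₃ : p₃ ∈ Set.Icc (0 : ℝ) 1)
    (N : ℕ) (bs : List ℕ) (m : ℕ) (hU : N + m * (1 + bs.sum) ≤ U.card) :
    expect (edgeProb p₂ p₃) (tryLayers bs m U) ≤ (1 - growProb p₂ p₃ N bs 0 1) ^ m := by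
  have hs := growProb_mem_Icc h₂ h₃ N bs 0 1
  induction m generalizing U with
  | zero =>
    have : tryLayers bs 0 U = fun _ => (1 : ℝ) := rfl
    rw [this, expect_const, pow_zero]
  | succ m ih =>
    rw [add_mul] at hU
    have hne : U.Nonempty := by rw [← Finset.card_pos]; omega
    have h1 : tryLayers bs (m + 1) U = growLayers (tryLayers bs m) U bs ∅ {hne.choose} := by
      funext E; simp only [tryLayers, dif_pos hne]
    rw [h1, pow_succ']
    refine (expect_growLayers_le h₂ h₃ (pow_nonneg (sub_nonneg.2 hs.2) m)
      (u := N + m * (1 + bs.sum)) (Nat.le_add_right _ _)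
      (fun R U' h E => tryLayers_sdiff_nearlyInside bs m h) (fun U' h => ih h)
      bs (Finset.disjoint_empty_left _) ?_).trans (le_of_eq ?_)
    · simp only [Finset.card_empty, Finset.card_singleton]; omega
    · simp

end Finite

/-! ### Sets that can be reached from a vertex -/

/-- A set of vertices can be reached from `v` if it is obtained from `{v}` by adding vertices `w`
such that all vertices of some edge except `w` are already present. -/
inductive Reachable (E : Finset (Finset V)) (v : V) : Finset V → Prop
  | single : Reachable E v {v}
  | step {R : Finset V} {w : V} {e : Finset V} (hR : Reachable E v R) (he : e ∈ E)
      (he2 : 2 ≤ e.card) (hw : e \ R = {w}) : Reachable E v (insert w R)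

/-- The vertices of `W` can be added one by one: the edge for `w` needs only `R` to be present, so
earlier additions do no harm. -/
lemma Reachable.union {v : V} (hR : Reachable E v R) (W : Finset V)
    (hW : ∀ w ∈ W, ∃ e ∈ E, 2 ≤ e.card ∧ w ∈ e ∧ e ⊆ insert w R) : Reachable E v (R ∪ W) := by
  induction W using Finset.induction_on with
  | empty => simpa
  | insert a W _ ih =>
    have ih := ih fun w hw => hW w (Finset.mem_insert_of_mem hw)
    rw [Finset.union_insert]
    by_cases ha : a ∈ R ∪ W
    · rwa [Finset.insert_eq_of_mem ha]
    · obtain ⟨e, he, he2, hae, heR⟩ := hW a (Finset.mem_insert_self _ _)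
      refine ih.step he he2 ?_
      ext x
      simp only [Finset.mem_sdiff, Finset.mem_singleton]
      constructor
      · rintro ⟨hx, hxR⟩
        have := heR hx
        simp only [Finset.mem_insert, Finset.mem_union] at this hxR
        grind
      · rintro rfl
        exact ⟨hae, ha⟩

lemma Reachable.union_hit {v : V} (hR : Reachable E v (D ∪ L)) {W : Finset V}
    (hW : W ⊆ hit E (U \ (D ∪ L)) D L) : Reachable E v (D ∪ L ∪ W) := by
  refine hR.union W fun w hw => ?_
  have hw' := hW hw
  rw [hit, Finset.mem_filter, Finset.not_disjoint_iff] at hw'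
  obtain ⟨hwU, e, he, hel⟩ := hw'
  obtain ⟨h1, ⟨x, hx, hxe⟩, h2⟩ := mem_of_mem_links hel
  refine ⟨e, he, ?_, h1, h2⟩
  have hxw : x ≠ w := by
    rintro rfl
    exact (Finset.mem_sdiff.1 hwU).2 (Finset.mem_union_right _ hx)
  exact Finset.one_lt_card.2 ⟨x, hxe, w, h1, hxw⟩

/-- The value 0 means success, either of this attempt or of a later one; in the first case the last
layer alone has `M` vertices. -/
lemma exists_reachable_of_growLayers_eq_zero {v : V} {M : ℕ}
    (hr : ∀ U, r U E = 0 → ∃ v R, Reachable E v R ∧ M ≤ R.card) (bs : List ℕ)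
    (hDL : Reachable E v (D ∪ L)) (hM : M ≤ bs.getLastD L.card)
    (h0 : growLayers r U bs D L E = 0) : ∃ v R, Reachable E v R ∧ M ≤ R.card := by
  induction bs generalizing D L with
  | nil => exact ⟨v, _, hDL, hM.trans (Finset.card_le_card Finset.subset_union_right)⟩
  | cons b bs ih =>
    simp only [growLayers] at h0
    split_ifs at h0 with h
    · obtain ⟨hs, hc⟩ := (Finset.exists_subset_card_eq h).choose_spec
      refine ih (hDL.union_hit hs) ?_ h0
      rwa [hc, ← List.getLastD_cons]
    · exact hr _ h0

lemma exists_reachable_of_tryLayers_eq_zero {M : ℕ} (bs : List ℕ) (hM : M ≤ bs.getLastD 1) (m : ℕ)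
    (h0 : tryLayers bs m U E = 0) : ∃ v R, Reachable E v R ∧ M ≤ R.card := by
  induction m generalizing U with
  | zero => simp [tryLayers] at h0
  | succ m ih =>
    simp only [tryLayers] at h0
    split_ifs at h0 with h
    · refine exists_reachable_of_growLayers_eq_zero (v := h.choose) (fun U h => ih h) bs ?_ ?_ h0
      · rw [Finset.empty_union]; exact .single
      · simpa using hM
    · simp at h0

/-- List the edges in the order in which they add vertices. The statement on the union is needed in
the induction and fails for a single vertex, which is reached without any edge. -/
lemma Reachable.exists_edges {v : V} (hR : Reachable E v R) : ∃ e : ℕ → Set V,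
    (∀ i, 1 ≤ i → i ≤ R.card - 1 → e i ∈ edgeSetOf E) ∧
    (2 ≤ R.card → ⋃ i ∈ Set.Icc 1 (R.card - 1), e i = R) ∧
    ∀ l, 1 ≤ l → l ≤ R.card - 2 →
      (e (l + 1) ∩ ⋃ i ∈ Set.Icc 1 l, e i).ncard + 1 = (e (l + 1)).ncard := by
  induction hR with
  | single =>
    refine ⟨fun _ => ∅, fun i h1 h2 => ?_, fun h => ?_, fun l h1 h2 => ?_⟩
    · simp at h2; omega
    · simp at h
    · simp at h2; omega
  | @step R w ε hR he he2 hw ih =>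
    obtain ⟨e, h1, h2, h3⟩ := ih
    have hwε : w ∈ ε \ R := by rw [hw]; simp
    rw [Finset.mem_sdiff] at hwε
    rw [Finset.card_insert_of_notMem hwε.2]
    have hR1 : 1 ≤ R.card := by
      rw [Nat.one_le_iff_ne_zero, ← Nat.pos_iff_ne_zero, Finset.card_pos]
      by_contra h
      rw [Finset.not_nonempty_iff_eq_empty] at h
      rw [h, Finset.sdiff_empty] at hw
      simp [hw] at he2
    set c := R.card with hc
    set e' := Function.update e c (ε : Set V) with he'
    have hεsub : ∀ x ∈ ε, x = w ∨ x ∈ R := by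
      intro x hx
      by_cases hxR : x ∈ R
      · exact Or.inr hxR
      · left
        have : x ∈ ε \ R := by simp [hx, hxR]
        rw [hw] at this
        simpa using this
    have hun : ∀ l, l ≤ c - 1 → ⋃ i ∈ Set.Icc 1 l, e' i = ⋃ i ∈ Set.Icc 1 l, e i := by
      intro l hl
      refine Set.iUnion₂_congr fun i hi => ?_
      rw [he', Function.update_of_ne]
      have := hi.2
      omega
    have he'c : e' c = ε := by rw [he', Function.update_self]
    refine ⟨e', fun i hi1 hi2 => ?_, fun _ => ?_, fun l hl1 hl2 => ?_⟩
    · rcases eq_or_ne i c with rfl | hic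
      · rw [he'c]; exact ⟨ε, he, rfl⟩
      · rw [he', Function.update_of_ne hic]; exact h1 i hi1 (by omega)
    · have hIcc : Set.Icc 1 (c + 1 - 1) = insert c (Set.Icc 1 (c - 1)) := by
        ext i; simp only [Set.mem_Icc, Set.mem_insert_iff]; omega
      rw [hIcc, Set.biUnion_insert, he'c, hun _ le_rfl]
      -- For the first edge there is no earlier union to rely on; it has two vertices at least and
      -- lies in `insert w R`, hence equals it.
      rcases Nat.lt_or_ge c 2 with hc2 | hc2
      · have hc1 : c = 1 := by omega
        obtain ⟨a, ha⟩ := Finset.card_eq_one.1 (hc.symm.trans hc1)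
        have hE : Set.Icc 1 (c - 1) = ∅ := by rw [hc1]; simp
        rw [hE, Set.biUnion_empty, Set.union_empty, Finset.coe_inj]
        refine Finset.eq_of_subset_of_card_le (fun x hx => ?_) ?_
        · rw [Finset.mem_insert]; exact hεsub x hx
        · rw [Finset.card_insert_of_notMem hwε.2]; omega
      · rw [h2 hc2]
        ext x
        simp only [Set.mem_union, Finset.mem_coe, Finset.coe_insert, Set.mem_insert_iff]
        constructor
        · rintro (h | h)
          · exact hεsub x h
          · exact Or.inr h
        · rintro (rfl | h)
          · exact Or.inl hwε.1
          · exact Or.inr h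
    · rw [hun l (by omega)]
      rcases eq_or_ne (l + 1) c with hlc | hlc
      · rw [hlc, he'c, show l = c - 1 by omega, h2 (by omega), ← Finset.coe_inter,
          Set.ncard_coe_finset, Set.ncard_coe_finset]
        have := Finset.card_sdiff_add_card_inter ε R
        rw [hw, Finset.card_singleton] at this
        omega
      · rw [he', Function.update_of_ne hlc]
        exact h3 l hl1 (by omega)

variable [Fintype V]

lemma Reachable.univ_of_expanding {v : V} {M : ℕ} (hR : Reachable E v R) (hM : M ≤ R.card)
    (hE : ∀ S : Finset V, M ≤ S.card → S ≠ Finset.univ →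
      ∃ e ∈ E, 2 ≤ e.card ∧ ∃ w, e \ S = {w}) : Reachable E v Finset.univ := by
  induction hk : Fintype.card V - R.card generalizing R with
  | zero =>
    have : R = Finset.univ := (Finset.card_eq_iff_eq_univ R).1
      (le_antisymm (Finset.card_le_univ R) (by omega))
    rwa [this] at hR
  | succ k ih =>
    obtain ⟨e, he, he2, w, hw⟩ := hE R hM (by rintro rfl; simp at hk)
    have hwR : w ∉ R := by
      have : w ∈ e \ R := by rw [hw]; simp
      exact (Finset.mem_sdiff.1 this).2
    have hc := Finset.card_insert_of_notMem hwR
    exact ih (hR.step he he2 hw) (by omega) (by omega)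

lemma Reachable.propagationConnected {v : V} (h : Reachable E v Finset.univ) :
    (hypergraphOfEdges (edgeSetOf E)).PropagationConnected := by
  obtain ⟨e, h1, -, h3⟩ := h.exists_edges
  have hc : (hypergraphOfEdges (edgeSetOf E)).vertexSet.ncard = (Finset.univ : Finset V).card := by
    simp [hypergraphOfEdges, Set.ncard_univ, Nat.card_eq_fintype_card]
  refine ⟨e, ?_, ?_⟩
  · rw [hc]; exact h1
  · rw [hc]; exact h3

/-- In a propagation connected hypergraph, every proper set of vertices that contains a certain
vertex can be extended along an edge. -/
lemma exists_extending_edge (hV : 3 ≤ Fintype.card V)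
    (hE : ∀ e ∈ E, e.card = 2 ∨ e.card = 3)
    (h : (hypergraphOfEdges (edgeSetOf E)).PropagationConnected) :
    ∃ v : V, ∀ S : Finset V, v ∈ S → S ≠ Finset.univ →
      ∃ e ∈ E, (e.card = 2 ∨ e.card = 3) ∧ ∃ w, e \ S = {w} := by
  obtain ⟨e, h1, h2⟩ := h
  have hc : (hypergraphOfEdges (edgeSetOf E)).vertexSet.ncard = Fintype.card V := by
    simp [hypergraphOfEdges, Set.ncard_univ, Nat.card_eq_fintype_card]
  rw [hc] at h1 h2
  set n := Fintype.card V
  change ∀ i, 1 ≤ i → i ≤ n - 1 → e i ∈ edgeSetOf E at h1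
  have hch : ∀ i, ∃ s : Finset V, 1 ≤ i → i ≤ n - 1 → s ∈ E ∧ (s : Set V) = e i := by
    intro i
    by_cases hi : 1 ≤ i ∧ i ≤ n - 1
    · obtain ⟨s, hs, hse⟩ := h1 i hi.1 hi.2
      exact ⟨s, fun _ _ => ⟨hs, hse⟩⟩
    · exact ⟨∅, fun a b => absurd ⟨a, b⟩ hi⟩
  choose s hs using hch
  set T : ℕ → Finset V := fun l => (Finset.Icc 1 l).biUnion s with hT
  have hTe : ∀ l, l ≤ n - 1 → ⋃ i ∈ Set.Icc 1 l, e i = T l := by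
    intro l hl
    rw [hT]
    simp only [Finset.coe_biUnion, Finset.coe_Icc]
    refine Set.iUnion₂_congr fun i hi => ?_
    rw [(hs i hi.1 (hi.2.trans hl)).2]
  have hstep : ∀ l, 1 ≤ l → l ≤ n - 2 → (s (l + 1) \ T l).card = 1 := by
    intro l hl1 hl2
    have := h2 l hl1 hl2
    rw [hTe l (by omega), ← (hs (l + 1) (by omega) (by omega)).2, ← Finset.coe_inter,
      Set.ncard_coe_finset, Set.ncard_coe_finset] at this
    have := Finset.card_sdiff_add_card_inter (s (l + 1)) (T l)
    omega
  have hTsucc : ∀ l, T (l + 1) = s (l + 1) ∪ T l := by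
    intro l
    simp only [hT]
    rw [← Finset.insert_Icc_right_eq_Icc_add_one (by omega), Finset.biUnion_insert]
  have hcard : ∀ l, 1 ≤ l → l ≤ n - 1 → (T l).card = (s 1).card + (l - 1) := by
    intro l hl
    induction l, hl using Nat.le_induction with
    | base => intro _; simp [hT]
    | succ l hl ih =>
      intro hl2
      rw [hTsucc, ← Finset.sdiff_union_self_eq_union,
        Finset.card_union_of_disjoint Finset.sdiff_disjoint, hstep l hl (by omega), ih (by omega)]
      omega
  -- All n - 1 edges cover |e₁| + n - 2 ≤ n vertices. This forces the first edge to be a pair and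
  -- the union to be everything.
  have hlast := hcard (n - 1) (by omega) le_rfl
  have hle : (T (n - 1)).card ≤ n := Finset.card_le_univ _
  have hs1 := hE _ (hs 1 le_rfl (by omega)).1
  have hs12 : (s 1).card = 2 := by omega
  have huniv : T (n - 1) = Finset.univ := (Finset.card_eq_iff_eq_univ _).1 (by omega)
  obtain ⟨v, v', hvv, hvs⟩ := Finset.card_eq_two.1 hs12
  refine ⟨v, fun S hvS hS => ?_⟩
  -- The extending edge is the first one not contained in `S`: its predecessors lie in `S`, so it
  -- has at most one vertex outside. If it is the very first edge, it is a pair containing `v`.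
  have hex : ∃ i, 1 ≤ i ∧ i ≤ n - 1 ∧ ¬ s i ⊆ S := by
    by_contra! hcon
    apply hS
    rw [Finset.eq_univ_iff_forall]
    intro x
    have : x ∈ T (n - 1) := by rw [huniv]; simp
    rw [hT, Finset.mem_biUnion] at this
    obtain ⟨i, hi, hx⟩ := this
    rw [Finset.mem_Icc] at hi
    exact hcon i hi.1 hi.2 hx
  classical
  obtain ⟨hi1, hi2, hi3⟩ := Nat.find_spec hex
  have hmin := fun j (hj : j < Nat.find hex) => Nat.find_min hex hj
  set i := Nat.find hex
  refine ⟨s i, (hs i hi1 hi2).1, hE _ (hs i hi1 hi2).1, ?_⟩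
  rw [← Finset.card_eq_one]
  have hpos : 0 < (s i \ S).card := by
    rw [Finset.card_pos]; exact Finset.sdiff_nonempty.2 hi3
  refine le_antisymm ?_ hpos
  rcases Nat.lt_or_ge 1 i with hi | hi
  · have hTS : T (i - 1) ⊆ S := by
      rw [hT, Finset.biUnion_subset]
      intro j hj
      rw [Finset.mem_Icc] at hj
      by_contra hjS
      exact hmin j (by omega) ⟨hj.1, by omega, hjS⟩
    have := hstep (i - 1) (by omega) (by omega)
    rw [show i - 1 + 1 = i by omega] at this
    rw [← this]
    exact Finset.card_le_card (Finset.sdiff_subset_sdiff subset_rfl hTS)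
  · have : i = 1 := by omega
    rw [this, hvs]
    refine (Finset.card_le_card (t := {v'}) fun x hx => ?_).trans (by simp)
    simp only [Finset.mem_sdiff, Finset.mem_insert, Finset.mem_singleton] at hx ⊢
    grind

/-! ### Expansion of large sets -/

/-- The sets of three vertices with exactly two elements in `S`. -/
def crossing (S : Finset V) : Finset (Finset V) :=
  (S.powersetCard 2 ×ˢ Sᶜ).image fun z => insert z.2 z.1

lemma prod_crossing (p₂ p₃ : ℝ) (S : Finset V) :
    ∏ e ∈ crossing S, (1 - edgeProb p₂ p₃ e)
      = (1 - p₃) ^ (S.card.choose 2 * (Fintype.card V - S.card)) := by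
  have hmem : ∀ z ∈ S.powersetCard 2 ×ˢ Sᶜ, z.1 ⊆ S ∧ z.1.card = 2 ∧ z.2 ∉ S := by
    intro z hz
    rw [Finset.mem_product, Finset.mem_powersetCard, Finset.mem_compl] at hz
    exact ⟨hz.1.1, hz.1.2, hz.2⟩
  rw [crossing, Finset.prod_image,
    Finset.prod_congr (s₁ := S.powersetCard 2 ×ˢ Sᶜ) (g := fun _ => 1 - p₃) rfl fun z hz => by
      obtain ⟨h1, h2, h3⟩ := hmem z hz
      have : (insert z.2 z.1).card = 3 := by
        rw [Finset.card_insert_of_notMem fun h => h3 (h1 h), h2]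
      rw [edgeProb, if_neg (by omega), if_pos this]]
  · rw [Finset.prod_const, Finset.card_product, Finset.card_powersetCard, Finset.card_compl]
  · rintro ⟨A, w⟩ hz ⟨A', w'⟩ hz' h
    obtain ⟨h1, -, h3⟩ := hmem _ hz
    obtain ⟨h1', -, h3'⟩ := hmem _ hz'
    simp only at h h1 h3 h1' h3'
    -- Intersecting the triple with `S` recovers its pair, so distinct choices give distinct
    -- triples.
    have hA : A = A' := by
      have : (insert w A) ∩ S = (insert w' A') ∩ S := by rw [h]
      rwa [Finset.insert_inter_of_notMem h3, Finset.insert_inter_of_notMem h3',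
        Finset.inter_eq_left.2 h1, Finset.inter_eq_left.2 h1'] at this
    have hw : w ∈ insert w' A' := by rw [← h]; simp
    rw [Finset.mem_insert] at hw
    have hw' := hw.resolve_right fun hw => h3 (h1' hw)
    rw [hA, hw']

lemma exists_of_not_disjoint_crossing {S : Finset V} (h : ¬ Disjoint E (crossing S)) :
    ∃ e ∈ E, 2 ≤ e.card ∧ ∃ w, e \ S = {w} := by
  obtain ⟨e, he, hes⟩ := Finset.not_disjoint_iff.1 h
  obtain ⟨⟨A, w⟩, hz, rfl⟩ := Finset.mem_image.1 hes
  rw [Finset.mem_product, Finset.mem_powersetCard, Finset.mem_compl] at hz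
  refine ⟨_, he, ?_, w, ?_⟩
  · have := Finset.card_le_card (Finset.subset_insert w A)
    simp only at hz ⊢
    omega
  · rw [Finset.insert_sdiff_of_notMem _ hz.2, Finset.sdiff_eq_empty_iff_subset.2 hz.1.1]
    rfl

open Classical in
/-- A bound for the probability that the random hypergraph is not propagation connected. -/
lemma expect_not_propagationConnected_le {p₂ p₃ : ℝ} (h₂ : p₂ ∈ Set.Icc (0 : ℝ) 1)
    (h₃ : p₃ ∈ Set.Icc (0 : ℝ) 1) {N M m : ℕ} {bs : List ℕ}
    (hN : N + m * (1 + bs.sum) ≤ Fintype.card V) (hM : M ≤ bs.getLastD 1) :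
    expect (edgeProb p₂ p₃) (fun E : Finset (Finset V) =>
        if ¬ (hypergraphOfEdges (edgeSetOf E)).PropagationConnected then 1 else 0)
      ≤ (1 - growProb p₂ p₃ N bs 0 1) ^ m
        + ∑ a ∈ Finset.Ico M (Fintype.card V), (Fintype.card V).choose a *
            (1 - p₃) ^ (a.choose 2 * (Fintype.card V - a)) := by
  set F : Finset (Finset V) := Finset.univ.filter fun S => M ≤ S.card ∧ S ≠ Finset.univ with hF
  -- If some attempt succeeds and every proper set of at least `M` vertices has a crossing edge, the
  -- reached set expands to all vertices. Otherwise one of the terms on the right is at least 1.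
  have h1 : ∀ E : Finset (Finset V),
      (if ¬ (hypergraphOfEdges (edgeSetOf E)).PropagationConnected then (1 : ℝ) else 0)
        ≤ tryLayers bs m Finset.univ E
          + ∑ S ∈ F, (if Disjoint E (crossing S) then 1 else 0) := by
    intro E
    have hnn : ∀ S ∈ F, (0 : ℝ) ≤ if Disjoint E (crossing S) then 1 else 0 := by
      intro S _; split_ifs <;> norm_num
    have hsum := Finset.sum_nonneg hnn
    by_cases hE : ∃ S ∈ F, Disjoint E (crossing S)
    · obtain ⟨S, hS, hd⟩ := hE
      have h3 := Finset.single_le_sum hnn hS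
      rw [if_pos hd] at h3
      have h4 : 0 ≤ tryLayers bs m Finset.univ E := by
        rcases tryLayers_eq_zero_or_one bs m Finset.univ E with h | h <;> simp [h]
      split_ifs <;> linarith
    · rcases tryLayers_eq_zero_or_one bs m Finset.univ E with h | h
      · rw [if_neg]
        · linarith
        · rw [not_not]
          obtain ⟨v, R, hR, hRM⟩ := exists_reachable_of_tryLayers_eq_zero bs hM m h
          refine (hR.univ_of_expanding hRM fun S hS hS' => ?_).propagationConnected
          push Not at hE
          exact exists_of_not_disjoint_crossing (hE S (by simp [hF, hS, hS']))
      · split_ifs <;> linarith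
  refine (expect_mono (edgeProb_mem_Icc h₂ h₃) h1).trans ?_
  rw [expect_add, expect_sum]
  refine add_le_add (expect_tryLayers_le h₂ h₃ N bs m (by simpa using hN)) (le_of_eq ?_)
  have h5 : ∀ S ∈ F, S.card ∈ Finset.Ico M (Fintype.card V) := by
    intro S hS
    rw [hF, Finset.mem_filter] at hS
    rw [Finset.mem_Ico]
    exact ⟨hS.2.1, lt_of_le_of_ne (Finset.card_le_univ S)
      fun h => hS.2.2 ((Finset.card_eq_iff_eq_univ S).1 h)⟩
  rw [← Finset.sum_fiberwise_of_maps_to h5]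
  refine Finset.sum_congr rfl fun a ha => ?_
  rw [Finset.mem_Ico] at ha
  have h6 : F.filter (fun S => S.card = a) = Finset.univ.powersetCard a := by
    ext S
    simp only [hF, Finset.mem_filter, Finset.mem_univ, true_and, Finset.mem_powersetCard,
      Finset.subset_univ]
    refine ⟨fun h => h.2, fun h => ⟨⟨h ▸ ha.1, ?_⟩, h⟩⟩
    rintro rfl
    rw [Finset.card_univ] at h
    omega
  rw [h6, Finset.sum_congr rfl (g := fun _ => (1 - p₃) ^ (a.choose 2 * (Fintype.card V - a)))]
  · rw [Finset.sum_const, Finset.card_powersetCard, Finset.card_univ, nsmul_eq_mul]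
  · intro S hS
    rw [expect_avoid, prod_crossing, (Finset.mem_powersetCard.1 hS).2]

open Classical in
/-- A bound for the probability that the random hypergraph is propagation connected. -/
lemma expect_propagationConnected_le {p₂ p₃ : ℝ} (h₂ : p₂ ∈ Set.Icc (0 : ℝ) 1)
    (h₃ : p₃ ∈ Set.Icc (0 : ℝ) 1) {θ c : ℕ → ℝ} (hθ : Antitone θ) (hθ0 : ∀ j, 0 ≤ θ j)
    (hc : ∀ j, Real.exp (-θ j) * (1 + linkProb p₂ p₃ j 1 * (Real.exp (θ j) - 1)) ^ Fintype.card V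
      ≤ c j) {k : ℕ} (hk : k < Fintype.card V) (hV : 3 ≤ Fintype.card V) :
    expect (edgeProb p₂ p₃) (fun E : Finset (Finset V) =>
        if (hypergraphOfEdges (edgeSetOf E)).PropagationConnected then 1 else 0)
      ≤ Fintype.card V * ∏ i ∈ Finset.range k, c i := by
  -- Union bound over the starting vertex; the special vertex of `exists_extending_edge` contributes
  -- 1.
  have h1 : ∀ E : Finset (Finset V), (∀ e ∈ E, edgeProb p₂ p₃ e ≠ 0) →
      (if (hypergraphOfEdges (edgeSetOf E)).PropagationConnected then (1 : ℝ) else 0)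
        ≤ ∑ v : V, survive k ∅ {v} E := by
    intro E hE
    split_ifs with h
    · have hE' : ∀ e ∈ E, e.card = 2 ∨ e.card = 3 := by
        intro e he
        have := hE e he
        unfold edgeProb at this
        split_ifs at this <;> simp_all
      obtain ⟨v, hv⟩ := exists_extending_edge hV hE' h
      rw [← survive_eq_one hv k (D := ∅) (A := {v}) (by simp) (by simpa using hk) ?_]
      · exact Finset.single_le_sum (f := fun v => survive k ∅ {v} E)
          (fun v _ => survive_nonneg k ∅ {v}) (Finset.mem_univ v)
      · intro e he he2 w hw
        rw [Finset.sdiff_empty] at hw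
        simp [hw] at he2
    · exact Finset.sum_nonneg fun v _ => survive_nonneg k ∅ {v}
  refine (expect_mono_of_ne_zero (edgeProb_mem_Icc h₂ h₃) h1).trans ?_
  rw [expect_sum]
  refine (Finset.sum_le_card_nsmul _ _ (∏ i ∈ Finset.range k, c i) fun v _ => ?_).trans ?_
  · refine (expect_survive_le h₂ h₃ hθ hθ0 hc k (Finset.disjoint_empty_left {v})).trans
      (le_of_eq ?_)
    simp
  · rw [nsmul_eq_mul, Finset.card_univ]

end Layers

/-! ### The rate function and its integral -/

section Rate

/-- The exponential rate at which the exploration dies out at time `w`. -/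
noncomputable def rate (ε r w : ℝ) : ℝ := 1 - min 1 (lam ε r w) + Real.log (min 1 (lam ε r w))

variable {ε r : ℝ}

lemma lam_pos (hε1 : ε < 1) (hr : 0 < r) {w : ℝ} (hw : 0 ≤ w) : 0 < lam ε r w := by
  unfold lam; nlinarith [mul_nonneg hr.le hw]

lemma lam_mono (hr : 0 < r) : Monotone (lam ε r) := fun a b h => by
  unfold lam; nlinarith

lemma min_one_lam_pos (hε1 : ε < 1) (hr : 0 < r) {w : ℝ} (hw : 0 ≤ w) : 0 < min 1 (lam ε r w) :=
  lt_min one_pos (lam_pos hε1 hr hw)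

lemma rate_nonpos (hε1 : ε < 1) (hr : 0 < r) {w : ℝ} (hw : 0 ≤ w) : rate ε r w ≤ 0 := by
  have := Real.log_le_sub_one_of_pos (min_one_lam_pos hε1 hr hw)
  unfold rate; linarith

lemma lam_div_self (hr : 0 < r) : lam ε r (ε / r) = 1 := by
  unfold lam; field_simp; ring

lemma rate_eq_zero (hr : 0 < r) {w : ℝ} (hw : ε / r ≤ w) : rate ε r w = 0 := by
  have := lam_mono (ε := ε) hr hw
  rw [lam_div_self hr] at this
  simp [rate, min_eq_left this]

/-- The function 1 - x + ln x increases on (0, 1], and the truncation of λ at 1 is monotone with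
values there. Monotonicity is what permits comparing sums with integrals. -/
lemma rate_monotoneOn (hε1 : ε < 1) (hr : 0 < r) : MonotoneOn (rate ε r) (Set.Ici 0) := by
  intro a ha b hb hab
  have hx := min_one_lam_pos hε1 hr ha
  have hy := min_one_lam_pos hε1 hr hb
  have hxy : min 1 (lam ε r a) ≤ min 1 (lam ε r b) := min_le_min_left 1 (lam_mono hr hab)
  have hy1 : min 1 (lam ε r b) ≤ 1 := min_le_left _ _
  unfold rate
  set x := min 1 (lam ε r a)
  set y := min 1 (lam ε r b)
  have h1 := Real.one_sub_inv_le_log_of_pos (div_pos hy hx)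
  rw [Real.log_div hy.ne' hx.ne', inv_div] at h1
  have h2 : y - x ≤ 1 - x / y := by
    rw [one_sub_div hy.ne', le_div_iff₀ hy]
    nlinarith
  linarith

lemma rate_intervalIntegrable (hε1 : ε < 1) (hr : 0 < r) {a b : ℝ} (ha : 0 ≤ a) (hb : 0 ≤ b) :
    IntervalIntegrable (rate ε r) volume a b := by
  refine ((rate_monotoneOn hε1 hr).mono fun x hx => ?_).intervalIntegrable
  exact (le_min ha hb).trans hx.1

lemma integral_rate (hε0 : 0 < ε) (hr : 0 < r) :
    ∫ w in (0 : ℝ)..(ε / r), rate ε r w = thresholdI ε r := by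
  refine intervalIntegral.integral_congr fun w hw => ?_
  rw [Set.uIcc_of_le (by positivity)] at hw
  have := lam_mono (ε := ε) hr hw.2
  rw [lam_div_self hr] at this
  simp only [rate, min_eq_right this]

lemma integral_rate_of_le (hε0 : 0 < ε) (hε1 : ε < 1) (hr : 0 < r) {a : ℝ} (ha : ε / r ≤ a) :
    ∫ w in (0 : ℝ)..a, rate ε r w = thresholdI ε r := by
  have h0 : 0 ≤ ε / r := by positivity
  rw [← intervalIntegral.integral_add_adjacent_intervals
    (rate_intervalIntegrable hε1 hr le_rfl h0) (rate_intervalIntegrable hε1 hr h0 (h0.trans ha)),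
    integral_rate hε0 hr, intervalIntegral.integral_congr (g := fun _ => 0)]
  · simp
  · intro w hw
    rw [Set.uIcc_of_le ha] at hw
    exact rate_eq_zero hr hw.1

/-- The rate is nonpositive, so stopping early only increases the integral. -/
lemma le_integral_rate (hε0 : 0 < ε) (hε1 : ε < 1) (hr : 0 < r) {a : ℝ} (ha : 0 ≤ a) :
    thresholdI ε r ≤ ∫ w in (0 : ℝ)..a, rate ε r w := by
  have hb : ε / r ≤ a + ε / r := by linarith
  have h0 : 0 < ε / r := by positivity
  rw [← integral_rate_of_le hε0 hε1 hr hb, ← intervalIntegral.integral_add_adjacent_intervals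
    (rate_intervalIntegrable hε1 hr le_rfl ha)
    (rate_intervalIntegrable hε1 hr ha (show 0 ≤ a + ε / r by linarith))]
  have : ∫ w in a..(a + ε / r), rate ε r w ≤ ∫ w in a..(a + ε / r), (0 : ℝ) :=
    intervalIntegral.integral_mono_on (by linarith)
      (rate_intervalIntegrable hε1 hr ha (by linarith)) (by simp)
      fun w hw => rate_nonpos hε1 hr (ha.trans hw.1)
  rw [intervalIntegral.integral_zero] at this
  linarith

lemma rate_div_monotoneOn (hε1 : ε < 1) (hr : 0 < r) {ℓ : ℝ} (hℓ : 0 < ℓ) (b : ℝ) :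
    MonotoneOn (fun x => rate ε r (x / ℓ)) (Set.Icc 0 b) := fun x hx y hy hxy =>
  rate_monotoneOn hε1 hr (div_nonneg hx.1 hℓ.le) (div_nonneg hy.1 hℓ.le) (by gcongr)

/-- For an increasing function, the sum over left endpoints is at most the integral, which is
complete once the range passes ε/r. -/
lemma sum_rate_le (hε0 : 0 < ε) (hε1 : ε < 1) (hr : 0 < r) {ℓ : ℝ} (hℓ : 0 < ℓ) {k : ℕ}
    (hk : ε / r * ℓ ≤ k) : ∑ j ∈ Finset.range k, rate ε r (j / ℓ) ≤ ℓ * thresholdI ε r := by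
  have h := MonotoneOn.sum_le_integral (x₀ := 0) (a := k) (f := fun x => rate ε r (x / ℓ))
    (rate_div_monotoneOn hε1 hr hℓ _)
  simp only [zero_add] at h
  rw [intervalIntegral.integral_comp_div _ hℓ.ne', zero_div,
    integral_rate_of_le hε0 hε1 hr ((le_div_iff₀ hℓ).2 hk), smul_eq_mul] at h
  exact h

/-- The terms after the first are right endpoint values and bound the integral from above; the first
term is the only loss. -/
lemma le_sum_rate (hε0 : 0 < ε) (hε1 : ε < 1) (hr : 0 < r) {ℓ : ℝ} (hℓ : 0 < ℓ) (k : ℕ) :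
    rate ε r 0 + ℓ * thresholdI ε r ≤ ∑ j ∈ Finset.range k, rate ε r (j / ℓ) := by
  have hI : thresholdI ε r ≤ 0 := by
    simpa using le_integral_rate hε0 hε1 hr le_rfl
  have h0 := rate_nonpos hε1 hr (w := 0) le_rfl
  cases k with
  | zero => simp only [Finset.range_zero, Finset.sum_empty]; nlinarith
  | succ k =>
    have h := MonotoneOn.integral_le_sum (x₀ := 0) (a := k) (f := fun x => rate ε r (x / ℓ))
      (rate_div_monotoneOn hε1 hr hℓ _)
    simp only [zero_add] at h
    rw [intervalIntegral.integral_comp_div _ hℓ.ne', zero_div, smul_eq_mul] at h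
    have h1 := mul_le_mul_of_nonneg_left
      (le_integral_rate hε0 hε1 hr (show (0 : ℝ) ≤ k / ℓ by positivity)) hℓ.le
    rw [Finset.sum_range_succ', Nat.cast_zero, zero_div]
    linarith

lemma thresholdI_eq (hε0 : 0 < ε) (hε1 : ε < 1) (hr : 0 < r) :
    thresholdI ε r = -(1 / r) * (ε - ε ^ 2 / 2 + (1 - ε) * Real.log (1 - ε)) := by
  have h0 : 0 ≤ ε / r := by positivity
  -- An antiderivative, using 1 - λ = ε - r w and that λ ln λ - λ has derivative r ln λ.
  have hd : ∀ w ∈ Set.uIcc 0 (ε / r), HasDerivAt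
      (fun w => ε * w - r * w ^ 2 / 2 + 1 / r * (lam ε r w * Real.log (lam ε r w) - lam ε r w))
      (1 - lam ε r w + Real.log (lam ε r w)) w := by
    intro w hw
    rw [Set.uIcc_of_le h0] at hw
    have hl := lam_pos hε1 hr hw.1
    have h1 : HasDerivAt (lam ε r) r w := by
      unfold lam
      simpa using ((hasDerivAt_id w).const_mul r).const_add (1 - ε)
    have h2 := (Real.hasDerivAt_mul_log hl.ne').comp w h1
    have h3 := (((hasDerivAt_id w).const_mul ε).sub
      ((((hasDerivAt_id w).pow 2).const_mul r).div_const 2)).add ((h2.sub h1).const_mul (1 / r))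
    refine h3.congr_deriv ?_
    simp only [id]
    unfold lam
    field_simp
    ring
  have hc : ContinuousOn (fun w => 1 - lam ε r w + Real.log (lam ε r w)) (Set.uIcc 0 (ε / r)) := by
    intro w hw
    rw [Set.uIcc_of_le h0] at hw
    have hl := lam_pos hε1 hr hw.1
    have h1 : Continuous (lam ε r) := by unfold lam; fun_prop
    exact (((continuous_const.sub h1).continuousAt).add
      (h1.continuousAt.log hl.ne')).continuousWithinAt
  rw [thresholdI, intervalIntegral.integral_eq_sub_of_hasDerivAt hd hc.intervalIntegrable,
    lam_div_self hr]
  simp only [lam, Real.log_one]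
  field_simp
  ring_nf

end Rate

/-! ### The case I < -1 -/

section Subcritical

variable {ε r : ℝ}

open Classical in
lemma expect_propagationConnected_le_exp (hε0 : 0 < ε) (hε1 : ε < 1) (hr : 0 < r) {n : ℕ}
    (hn : 3 ≤ n) {p₂ p₃ : ℝ} (h₂ : p₂ ∈ Set.Icc (0 : ℝ) 1) (h₃ : p₃ ∈ Set.Icc (0 : ℝ) 1)
    (hp₂ : p₂ = (1 - ε) / n) (hp₃ : p₃ = r / (n * Real.log n))
    (hk : ⌈ε / r * Real.log n⌉₊ < n) :
    expect (edgeProb p₂ p₃) (fun E : Finset (Finset (Fin n)) =>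
        if (hypergraphOfEdges (edgeSetOf E)).PropagationConnected then 1 else 0)
      ≤ Real.exp ((1 + thresholdI ε r) * Real.log n) := by
  have hn0 : (0 : ℝ) < n := by positivity
  have hℓ : 0 < Real.log n := Real.log_pos (by exact_mod_cast (by omega : 1 < n))
  set ℓ := Real.log n with hℓdef
  have hj : ∀ j : ℕ, (0 : ℝ) ≤ j / ℓ := fun j => by positivity
  have hpos := fun j : ℕ => min_one_lam_pos hε1 hr (hj j)
  -- The optimal Chernoff tilt for a Poisson variable of mean λ is exp θ = 1/λ. Truncation at 1
  -- switches the tilt off once λ ≥ 1 and keeps it nonnegative.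
  set θ : ℕ → ℝ := fun j => -Real.log (min 1 (lam ε r (j / ℓ))) with hθ
  have hθa : Antitone θ := fun i j hij => neg_le_neg (Real.log_le_log (hpos i)
    (min_le_min_left 1 (lam_mono hr (by gcongr))))
  have hθ0 : ∀ j, 0 ≤ θ j := fun j =>
    neg_nonneg.2 (Real.log_nonpos (hpos j).le (min_le_left _ _))
  have hc : ∀ j, Real.exp (-θ j) *
      (1 + linkProb p₂ p₃ j 1 * (Real.exp (θ j) - 1)) ^ Fintype.card (Fin n)
      ≤ Real.exp (rate ε r (j / ℓ)) := by
    intro j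
    have hexp : 0 ≤ Real.exp (θ j) - 1 := by linarith [Real.add_one_le_exp (θ j), hθ0 j]
    have hq := linkProb_mem_Icc h₂ h₃ j 1
    -- Union bound over the single possible 2-edge and the `j` possible 3-edges.
    have hq1 : n * linkProb p₂ p₃ j 1 ≤ lam ε r (j / ℓ) := by
      have hb : 1 - j * p₃ ≤ (1 - p₃) ^ j := by
        have := one_add_mul_le_pow (a := -p₃) (by linarith [h₃.2]) j
        rw [← sub_eq_add_neg] at this; linarith
      have h1 : linkProb p₂ p₃ j 1 ≤ p₂ + j * p₃ := by
        have e1 := mul_le_mul_of_nonneg_left hb (sub_nonneg.2 h₂.2)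
        have e2 : 0 ≤ p₂ * (j * p₃) :=
          mul_nonneg h₂.1 (mul_nonneg (Nat.cast_nonneg j) h₃.1)
        rw [linkProb, pow_one, one_mul]
        nlinarith
      refine (mul_le_mul_of_nonneg_left h1 hn0.le).trans (le_of_eq ?_)
      rw [hp₂, hp₃, lam]; field_simp
    rw [Fintype.card_fin]
    have h2 : (1 + linkProb p₂ p₃ j 1 * (Real.exp (θ j) - 1)) ^ n
        ≤ Real.exp (lam ε r (j / ℓ) * (Real.exp (θ j) - 1)) := by
      have h3 := mul_nonneg hq.1 hexp
      refine (pow_le_pow_left₀ (by linarith)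
        ((add_comm _ _).trans_le (Real.add_one_le_exp _)) n).trans ?_
      rw [← Real.exp_nat_mul, Real.exp_le_exp, ← mul_assoc]
      exact mul_le_mul_of_nonneg_right hq1 hexp
    refine (mul_le_mul_of_nonneg_left h2 (Real.exp_pos _).le).trans ?_
    rw [← Real.exp_add, Real.exp_le_exp]
    -- For λ ≤ 1 the factor is λ exp(1 - λ), the exponential of the rate; for λ ≥ 1 both sides are
    -- 1.
    simp only [hθ, neg_neg, Real.exp_neg, Real.exp_log (hpos j), rate]
    rcases le_total (lam ε r (j / ℓ)) 1 with h | h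
    · have := lam_pos hε1 hr (hj j)
      rw [min_eq_right h, mul_sub, mul_inv_cancel₀ this.ne']
      linarith
    · rw [min_eq_left h]; simp
  -- Running up to time ε/r suffices, since the rate vanishes from then on.
  refine (expect_propagationConnected_le h₂ h₃ hθa hθ0 hc (k := ⌈ε / r * ℓ⌉₊)
    (by simpa using hk) (by simpa using hn)).trans ?_
  rw [← Real.exp_sum, Fintype.card_fin, add_mul, one_mul, Real.exp_add, hℓdef, Real.exp_log hn0,
    ← hℓdef]
  refine mul_le_mul_of_nonneg_left (Real.exp_le_exp.2 ?_) hn0.le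
  rw [mul_comm (thresholdI ε r)]
  exact sum_rate_le hε0 hε1 hr hℓ (Nat.le_ceil _)

lemma tendsto_log_natCast : Tendsto (fun n : ℕ => Real.log n) atTop atTop :=
  Real.tendsto_log_atTop.comp tendsto_natCast_atTop_atTop

lemma tendsto_not_propagationConnected (hε0 : 0 < ε) (hε1 : ε < 1) (hr : 0 < r)
    {p₂ p₃ : ℕ → unitInterval}
    (hp₂ : ∀ᶠ n : ℕ in atTop, (p₂ n : ℝ) = (1 - ε) / n)
    (hp₃ : ∀ᶠ n : ℕ in atTop, (p₃ n : ℝ) = r / (n * Real.log n))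
    (hI : thresholdI ε r < -1) :
    Tendsto (fun n : ℕ => (randomEdges n (p₂ n) (p₃ n)).real
        {ω | ¬ (randomHypergraph n ω).PropagationConnected}) atTop (𝓝 1) := by
  classical
  have h1 : Tendsto (fun n : ℕ => 1 - Real.exp ((1 + thresholdI ε r) * Real.log n)) atTop
      (𝓝 1) := by
    have : Tendsto (fun n : ℕ => (1 + thresholdI ε r) * Real.log n) atTop atBot :=
      tendsto_log_natCast.const_mul_atTop_of_neg (by linarith)
    simpa using (Real.tendsto_exp_atBot.comp this).const_sub 1
  have hk : ∀ᶠ n : ℕ in atTop, ⌈ε / r * Real.log n⌉₊ < n := by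
    have h2 : (fun n : ℕ => Real.log n) =o[atTop] (fun n : ℕ => (n : ℝ)) :=
      Real.isLittleO_log_id_atTop.comp_tendsto tendsto_natCast_atTop_atTop
    have hc : 0 < (2 * (ε / r))⁻¹ := by positivity
    filter_upwards [h2.bound hc, eventually_ge_atTop 3] with n hn hn3
    have hn3' : (3 : ℝ) ≤ n := by exact_mod_cast hn3
    have hl : 0 ≤ Real.log n := Real.log_nonneg (by linarith)
    rw [Real.norm_of_nonneg hl, Real.norm_of_nonneg (by positivity),
      ← div_eq_inv_mul, le_div_iff₀ (by positivity)] at hn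
    have h3 := Nat.ceil_lt_add_one (show 0 ≤ ε / r * Real.log n by positivity)
    have h4 : (⌈ε / r * Real.log n⌉₊ : ℝ) < n := by nlinarith
    exact_mod_cast h4
  refine tendsto_of_tendsto_of_tendsto_of_le_of_le' h1 tendsto_const_nhds ?_ ?_
  · filter_upwards [hp₂, hp₃, hk, eventually_ge_atTop 3] with n hn₂ hn₃ hnk hn
    have h := expect_propagationConnected_le_exp hε0 hε1 hr hn (p₂ n).2 (p₃ n).2 hn₂ hn₃ hnk
    simp only [randomHypergraph]
    rw [measureReal_randomEdges n _ _ fun A => ¬ (hypergraphOfEdges A).PropagationConnected]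
    have h5 : (fun E : Finset (Finset (Fin n)) =>
        if ¬ (hypergraphOfEdges (edgeSetOf E)).PropagationConnected then (1 : ℝ) else 0)
        = fun E => 1 - if (hypergraphOfEdges (edgeSetOf E)).PropagationConnected then 1 else 0 := by
      funext E; split_ifs <;> simp
    rw [h5, expect_sub, expect_const]
    linarith
  · refine Eventually.of_forall fun n => ?_
    have : IsProbabilityMeasure (randomEdges n (p₂ n) (p₃ n)) := by
      unfold randomEdges; infer_instance
    exact measureReal_le_one

end Subcritical

/-! ### Probability of a successful attempt and expansion of large sets -/

section Supercritical

variable {ε r : ℝ}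

/-- A first moment bound for the number of large sets that cannot be extended along an edge. -/
lemma sum_choose_mul_le (hr : 0 < r) {n M : ℕ} {p₃ : ℝ} (hn : 3 ≤ n)
    (h₃ : p₃ ∈ Set.Icc (0 : ℝ) 1) (hp₃ : p₃ = r / (n * Real.log n))
    (hM : 12 * Real.log n ^ 2 / r + 1 ≤ M) :
    ∑ a ∈ Finset.Ico M n, (n.choose a : ℝ) * (1 - p₃) ^ (a.choose 2 * (n - a))
      ≤ Real.exp (-Real.log n) := by
  have hn0 : (0 : ℝ) < n := by positivity
  have hℓ : 0 < Real.log n := Real.log_pos (by exact_mod_cast (by omega : 1 < n))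
  set ℓ := Real.log n with hℓdef
  have hexp : Real.exp ℓ = n := Real.exp_log hn0
  have hterm : ∀ a ∈ Finset.Ico M n, (n.choose a : ℝ) * (1 - p₃) ^ (a.choose 2 * (n - a))
      ≤ Real.exp (-(2 * ℓ)) := by
    intro a ha
    rw [Finset.mem_Ico] at ha
    have haM : (M : ℝ) ≤ a := by exact_mod_cast ha.1
    have haℓ : 12 * ℓ ^ 2 / r ≤ a - 1 := by linarith
    have ha1 : (1 : ℝ) ≤ a := by
      have : 0 ≤ 12 * ℓ ^ 2 / r := by positivity
      linarith
    have ha1' : 1 ≤ a := by exact_mod_cast ha1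
    -- With this `k`, the number of sets is at most n^k = exp(k ℓ), while a (n - a) ≥ k n / 2 makes
    -- the expected number of crossing edges at least r (a - 1) k / (4 ℓ) ≥ 3 k ℓ. Each term is then
    -- at most exp(-2 k ℓ) ≤ n^(-2).
    set k := min a (n - a) with hk
    have hk1 : 1 ≤ k := le_min ha1' (by omega)
    have hchoose : (n.choose a : ℝ) ≤ Real.exp (k * ℓ) := by
      rw [Real.exp_nat_mul, hexp]
      rcases le_total a (n - a) with h | h
      · rw [hk, min_eq_left h]; exact_mod_cast Nat.choose_le_pow n a
      · rw [hk, min_eq_right h, ← Nat.choose_symm ha.2.le]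
        exact_mod_cast Nat.choose_le_pow n (n - a)
    have hkn : (k : ℝ) * n ≤ 2 * (a * (n - a)) := by
      have hcast : ((n - a : ℕ) : ℝ) = n - a := Nat.cast_sub ha.2.le
      have hna : (0 : ℝ) ≤ n - a := by rw [← hcast]; positivity
      rcases le_total a (n - a) with h | h
      · rw [hk, min_eq_left h]
        have : (a : ℝ) ≤ n - a := by rw [← hcast]; exact_mod_cast h
        nlinarith
      · rw [hk, min_eq_right h, hcast]
        have : (n : ℝ) - a ≤ a := by rw [← hcast]; exact_mod_cast h
        nlinarith
    have hpow : (1 - p₃) ^ (a.choose 2 * (n - a)) ≤ Real.exp (-(3 * k * ℓ)) := by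
      have h1 : 1 - p₃ ≤ Real.exp (-p₃) := by
        have := Real.add_one_le_exp (-p₃); linarith
      refine (pow_le_pow_left₀ (sub_nonneg.2 h₃.2) h1 _).trans ?_
      rw [← Real.exp_nat_mul, Real.exp_le_exp, Nat.cast_mul, Nat.cast_choose_two,
        Nat.cast_sub ha.2.le]
      have h2 : 3 * k * ℓ ≤ r * (a - 1) * k / (4 * ℓ) := by
        rw [le_div_iff₀ (by positivity)]
        rw [div_le_iff₀ hr] at haℓ
        have := mul_le_mul_of_nonneg_right haℓ (Nat.cast_nonneg k)
        nlinarith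
      have h3 : r * (a - 1) * k / (4 * ℓ) ≤ (a * (a - 1) / 2 * (n - a)) * p₃ := by
        rw [hp₃, ← mul_div_assoc, div_le_div_iff₀ (by positivity) (by positivity)]
        have h4 : 0 ≤ r * (a - 1) * ℓ := mul_nonneg (mul_nonneg hr.le (by linarith)) hℓ.le
        have := mul_le_mul_of_nonneg_left hkn h4
        nlinarith
      linarith
    have h5 : 0 ≤ (1 - p₃) ^ (a.choose 2 * (n - a)) := pow_nonneg (sub_nonneg.2 h₃.2) _
    refine (mul_le_mul hchoose hpow h5 (Real.exp_pos _).le).trans ?_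
    rw [← Real.exp_add, Real.exp_le_exp]
    have : (1 : ℝ) ≤ k := by exact_mod_cast hk1
    nlinarith
  refine (Finset.sum_le_card_nsmul _ _ _ hterm).trans ?_
  rw [nsmul_eq_mul, Nat.card_Ico]
  calc ((n - M : ℕ) : ℝ) * Real.exp (-(2 * ℓ)) ≤ n * Real.exp (-(2 * ℓ)) := by
        gcongr; exact Nat.sub_le _ _
    _ = Real.exp (-ℓ) := by
        rw [← hexp, ← Real.exp_add]; congr 1; ring

lemma growProb_replicate_append (p₂ p₃ : ℝ) (N B J : ℕ) (bs : List ℕ) (d : ℕ) :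
    growProb p₂ p₃ N (List.replicate J B ++ bs) d B
      = (∏ i ∈ Finset.range J, binomTail (linkProb p₂ p₃ (d + i * B) B) N B)
        * growProb p₂ p₃ N bs (d + J * B) B := by
  induction J generalizing d with
  | zero => simp
  | succ J ih =>
    rw [List.replicate_succ, List.cons_append, growProb, ih, Finset.prod_range_succ']
    have h1 : ∀ i, d + B + i * B = d + (i + 1) * B := fun i => by ring
    simp only [h1]
    simp only [zero_mul, add_zero]
    ring

/-- The expected number of vertices that are linked to a set of `l` vertices, with the help of a
set of `d` vertices, is close to `l * lam ε r (d / log n)`. -/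
lemma le_mul_linkProb (hε0 : 0 < ε) (hε1 : ε < 1) (hr : 0 < r) {n N y d l : ℕ} {p₂ p₃ : ℝ}
    (h₂ : p₂ ∈ Set.Icc (0 : ℝ) 1) (h₃ : p₃ ∈ Set.Icc (0 : ℝ) 1)
    (hp₂ : p₂ = (1 - ε) / n) (hp₃ : p₃ = r / (n * Real.log n))
    (hy : 1 ≤ y) (hyr : 1 + r ≤ y) (hyℓ : (y : ℝ) ^ 10 ≤ Real.log n) (hyn : (y : ℝ) ^ 100 ≤ n)
    (hN : n * (1 - 1 / (y : ℝ) ^ 20) ≤ N) (hd : d ≤ y ^ 19) (hl : l ≤ y ^ 16) :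
    (1 - 2 / (y : ℝ) ^ 20) * (l * lam ε r (d / Real.log n)) ≤ N * linkProb p₂ p₃ d l := by
  have hy1 : (1 : ℝ) ≤ y := by exact_mod_cast hy
  have hn0 : (0 : ℝ) < n := lt_of_lt_of_le (by positivity) hyn
  set ℓ := Real.log n with hℓdef
  have hℓ1 : 1 ≤ ℓ := (one_le_pow₀ hy1).trans hyℓ
  have hℓ : 0 < ℓ := by linarith
  set x := (l : ℝ) * lam ε r (d / ℓ) with hx
  have hlam := lam_pos hε1 hr (show (0 : ℝ) ≤ d / ℓ by positivity)
  have hx0 : 0 ≤ x := mul_nonneg (Nat.cast_nonneg l) hlam.le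
  set z := x / n with hz
  have hz0 : 0 ≤ z := div_nonneg hx0 hn0.le
  have hz' : z = l * p₂ + (l * d : ℕ) * p₃ := by
    rw [hz, hx, lam, hp₂, hp₃]; push_cast; field_simp
  -- Here z is the expected number of links of one vertex, and 1 - exp(-z) ≥ z / (1 + z) ≥ z (1 -
  -- z).
  have hq : z * (1 - z) ≤ linkProb p₂ p₃ d l := by
    have e : ∀ p : ℝ, 1 - p ≤ Real.exp (-p) := fun p => by
      have := Real.add_one_le_exp (-p); linarith
    have h1 : (1 - p₂) ^ l * (1 - p₃) ^ (l * d) ≤ Real.exp (-z) := by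
      have e1 := pow_le_pow_left₀ (sub_nonneg.2 h₂.2) (e p₂) l
      have e2 := pow_le_pow_left₀ (sub_nonneg.2 h₃.2) (e p₃) (l * d)
      refine (mul_le_mul e1 e2 (pow_nonneg (sub_nonneg.2 h₃.2) _) (by positivity)).trans
        (le_of_eq ?_)
      rw [← Real.exp_nat_mul, ← Real.exp_nat_mul, ← Real.exp_add, hz']
      congr 1; ring
    have h2 : Real.exp (-z) ≤ 1 / (1 + z) := by
      rw [Real.exp_neg, ← one_div]
      exact one_div_le_one_div_of_le (by linarith) ((add_comm _ _).trans_le (Real.add_one_le_exp z))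
    have h3 : 1 / (1 + z) ≤ 1 - z * (1 - z) := by
      rw [div_le_iff₀ (by linarith)]
      nlinarith [mul_nonneg hz0 (mul_nonneg hz0 hz0)]
    rw [linkProb]; linarith
  have hzle : z ≤ 1 / (y : ℝ) ^ 20 := by
    have hd' : (d : ℝ) ≤ (y : ℝ) ^ 19 := by exact_mod_cast hd
    have hl' : (l : ℝ) ≤ (y : ℝ) ^ 16 := by exact_mod_cast hl
    have h1 : lam ε r (d / ℓ) ≤ (y : ℝ) ^ 20 := by
      have h2 : (d : ℝ) / ℓ ≤ (y : ℝ) ^ 19 := (div_le_self (Nat.cast_nonneg d) hℓ1).trans hd'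
      have h3 : (1 : ℝ) ≤ (y : ℝ) ^ 19 := one_le_pow₀ hy1
      unfold lam
      calc 1 - ε + r * (d / ℓ) ≤ 1 * (y : ℝ) ^ 19 + r * (y : ℝ) ^ 19 := by
            have := mul_le_mul_of_nonneg_left h2 hr.le
            linarith
        _ = (1 + r) * (y : ℝ) ^ 19 := by ring
        _ ≤ y * (y : ℝ) ^ 19 := by gcongr
        _ = (y : ℝ) ^ 20 := by ring
    have h4 : x ≤ (y : ℝ) ^ 16 * (y : ℝ) ^ 20 := mul_le_mul hl' h1 hlam.le (by positivity)
    rw [hz, div_le_div_iff₀ hn0 (by positivity), one_mul]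
    calc x * (y : ℝ) ^ 20 ≤ (y : ℝ) ^ 16 * (y : ℝ) ^ 20 * (y : ℝ) ^ 20 := by gcongr
      _ = (y : ℝ) ^ 56 := by ring
      _ ≤ (y : ℝ) ^ 100 := pow_le_pow_right₀ hy1 (by norm_num)
      _ ≤ n := hyn
  set δ := 1 / (y : ℝ) ^ 20 with hδ
  have hδ0 : 0 ≤ δ := by positivity
  have hδ1 : δ ≤ 1 := by
    rw [hδ, div_le_one (by positivity)]; exact one_le_pow₀ hy1
  have hxz : x = n * z := by rw [hz]; field_simp
  rw [show 2 / (y : ℝ) ^ 20 = 2 * δ by rw [hδ]; ring, hxz]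
  have h6 : z * (1 - δ) ≤ linkProb p₂ p₃ d l :=
    (mul_le_mul_of_nonneg_left (by linarith) hz0).trans hq
  have h7 : 0 ≤ z * (1 - δ) := mul_nonneg hz0 (by linarith)
  -- One factor 1 - δ pays for the used vertices, the other for the difference between z and the
  -- probability.
  calc (1 - 2 * δ) * (n * z) ≤ n * (1 - δ) * (z * (1 - δ)) := by
        nlinarith [mul_nonneg (mul_nonneg hn0.le hz0) (mul_nonneg hδ0 hδ0)]
    _ ≤ N * linkProb p₂ p₃ d l := mul_le_mul hN h6 h7 (Nat.cast_nonneg N)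

/-- The sizes of the layers: `y ^ 9 + 1` layers of size `y ^ 9`, followed by two larger ones. -/
def layerSizes (y : ℕ) : List ℕ :=
  y ^ 9 :: (List.replicate (y ^ 9) (y ^ 9) ++ [y ^ 16, y ^ 23])

lemma one_add_sum_layerSizes_le {y : ℕ} (hy : 5 ≤ y) : 1 + (layerSizes y).sum ≤ y ^ 24 := by
  have h : ∀ k, k ≤ 23 → y ^ k ≤ y ^ 23 := fun k hk => Nat.pow_le_pow_right (by omega) hk
  have h0 := h 0 (by norm_num)
  have h9 := h 9 (by norm_num)
  have h16 := h 16 (by norm_num)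
  have h18 := h 18 (by norm_num)
  have h24 : 5 * y ^ 23 ≤ y ^ 24 := by
    rw [pow_succ y 23, mul_comm]; exact Nat.mul_le_mul_left _ hy
  have : (layerSizes y).sum = y ^ 9 + (y ^ 18 + (y ^ 16 + y ^ 23)) := by
    simp [layerSizes]; ring
  rw [this]
  rw [pow_zero] at h0
  omega

/-- A lower bound for the probability to find a layer of size `b`, starting from a layer of size `l`
and `d` earlier vertices. -/
lemma exp_le_binomTail_linkProb (hε0 : 0 < ε) (hε1 : ε < 1) (hr : 0 < r) {n N y d l b : ℕ}
    {p₂ p₃ x : ℝ} (h₂ : p₂ ∈ Set.Icc (0 : ℝ) 1) (h₃ : p₃ ∈ Set.Icc (0 : ℝ) 1)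
    (hp₂ : p₂ = (1 - ε) / n) (hp₃ : p₃ = r / (n * Real.log n))
    (hy : 5 ≤ y) (hyr : 1 + r ≤ y) (hyℓ : (y : ℝ) ^ 10 ≤ Real.log n) (hyn : (y : ℝ) ^ 100 ≤ n)
    (hN : n * (1 - 1 / (y : ℝ) ^ 20) ≤ N) (hd : d ≤ y ^ 19) (hl : l ≤ y ^ 16)
    (hb : 1 ≤ b) (hb' : b ≤ y ^ 23) (hx0 : 0 < x) (hx1 : x ≤ 1)
    (hx : x * b ≤ (1 - 2 / (y : ℝ) ^ 20) * (l * lam ε r (d / Real.log n))) :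
    Real.exp (b * (1 - x + Real.log x) - (3 + 23 * Real.log y))
      ≤ binomTail (linkProb p₂ p₃ d l) N b := by
  have hy5 : (5 : ℝ) ≤ y := by exact_mod_cast hy
  have hy1 : (1 : ℝ) ≤ y := by linarith
  have hlink := hx.trans
    (le_mul_linkProb hε0 hε1 hr h₂ h₃ hp₂ hp₃ (by omega) hyr hyℓ hyn hN hd hl)
  have hb'' : (b : ℝ) ≤ (y : ℝ) ^ 23 := by exact_mod_cast hb'
  have hN2 : 2 * b ^ 2 ≤ N := by
    have h1 : (1 : ℝ) / (y : ℝ) ^ 20 ≤ 1 / 2 :=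
      one_div_le_one_div_of_le two_pos ((show (2 : ℝ) ≤ y by linarith).trans
        (le_self_pow₀ hy1 (by norm_num)))
    have h2 : (n : ℝ) / 2 ≤ N := by
      refine le_trans ?_ hN
      rw [div_eq_mul_one_div]
      exact mul_le_mul_of_nonneg_left (by linarith) (Nat.cast_nonneg n)
    have h3 : (2 : ℝ) * b ^ 2 ≤ N := by
      refine le_trans ?_ h2
      calc (2 : ℝ) * b ^ 2 ≤ 2 * ((y : ℝ) ^ 23) ^ 2 := by gcongr
        _ = (2 * 2 * (y : ℝ) ^ 46) / 2 := by ring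
        _ ≤ (y * y * (y : ℝ) ^ 46) / 2 := by gcongr; all_goals linarith
        _ = (y : ℝ) ^ 48 / 2 := by ring
        _ ≤ (y : ℝ) ^ 100 / 2 := by gcongr; norm_num
        _ ≤ n / 2 := by gcongr
    exact_mod_cast h3
  refine le_trans ?_ (le_binomTail (linkProb_mem_Icc h₂ h₃ d l).2 hb hN2 hx0 hx1 hlink)
  rw [Real.exp_sub]
  refine div_le_div_of_nonneg_left (Real.exp_pos _).le (by positivity) ?_
  -- The term 3 + 23 ln y absorbs the denominator 4 e b of `le_binomTail`, as 4 ≤ e² and b ≤ y^23.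
  have h1 : Real.exp (3 + 23 * Real.log y) = Real.exp 1 * Real.exp 2 * (y : ℝ) ^ 23 := by
    rw [show 3 + 23 * Real.log y = 1 + 2 + ((23 : ℕ) : ℝ) * Real.log y by push_cast; ring,
      Real.exp_add, Real.exp_add, Real.exp_nat_mul, Real.exp_log (by linarith)]
  have h2 : (4 : ℝ) ≤ Real.exp 2 := by
    have := Real.add_one_le_exp (1 : ℝ)
    rw [show (2 : ℝ) = 1 + 1 by norm_num, Real.exp_add]
    nlinarith
  rw [h1]
  calc 4 * Real.exp 1 * b ≤ Real.exp 2 * Real.exp 1 * (y : ℝ) ^ 23 := by gcongr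
    _ = _ := by ring

/-- The sum of the exponents of the bounds for the individual layers. -/
lemma le_sum_layers (hε0 : 0 < ε) (hε1 : ε < 1) (hr : 0 < r) {κ ℓ η : ℝ} {y : ℕ}
    (hy : 5 ≤ y) (hyℓ : (y : ℝ) ^ 10 ≤ ℓ) (hη0 : 0 ≤ η) (hη2 : η ≤ 1 / 2)
    (hηy : η * (y : ℝ) ^ 18 ≤ 1)
    (hyκ : 16 - Real.log ((1 - ε) / 2) - rate ε r 0 + 101 * Real.log y ≤ κ * y) (hκ : 0 ≤ κ) :
    ℓ * (thresholdI ε r - κ) ≤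
      ((y : ℝ) ^ 9 * (Real.log ((1 - ε) / 2) - 9 * Real.log y) - (3 + 23 * Real.log y))
      + (∑ i ∈ Finset.range (y ^ 9), ((y : ℝ) ^ 9 * (rate ε r (i / (ℓ / (y : ℝ) ^ 9))
          + Real.log (1 - η)) - (3 + 23 * Real.log y))
        + (-(3 + 23 * Real.log y) + -(3 + 23 * Real.log y))) := by
  have hy5 : (5 : ℝ) ≤ y := by exact_mod_cast hy
  have hy1 : (1 : ℝ) ≤ y := by linarith
  have hℓ : 0 < ℓ := lt_of_lt_of_le (by positivity) hyℓ
  have hlogy : 0 ≤ Real.log y := Real.log_nonneg hy1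
  -- The total loss from the factor 1 - η over y^9 layers of y^9 vertices is bounded.
  have h2 : -2 ≤ (y : ℝ) ^ 18 * Real.log (1 - η) := by
    have h3 := Real.one_sub_inv_le_log_of_pos (show 0 < 1 - η by linarith)
    have h4 : -(2 * η) ≤ 1 - (1 - η)⁻¹ := by
      have : (1 - η)⁻¹ ≤ 1 + 2 * η := by
        rw [inv_le_iff_one_le_mul₀ (by linarith)]; nlinarith
      linarith
    have := mul_le_mul_of_nonneg_left (h4.trans h3) (show (0 : ℝ) ≤ (y : ℝ) ^ 18 by positivity)
    linarith
  rw [Finset.sum_sub_distrib, Finset.sum_const, Finset.card_range, nsmul_eq_mul,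
    ← Finset.mul_sum, Finset.sum_add_distrib, Finset.sum_const, Finset.card_range,
    nsmul_eq_mul, Nat.cast_pow]
  have e18 : (y : ℝ) ^ 18 = (y : ℝ) ^ 9 * (y : ℝ) ^ 9 := by ring
  have e10 : (y : ℝ) ^ 10 = (y : ℝ) ^ 9 * y := by ring
  rw [e18] at h2
  rw [e10] at hyℓ
  have hB3 : (5 : ℝ) ≤ (y : ℝ) ^ 9 := hy5.trans (le_self_pow₀ hy1 (by norm_num))
  generalize (y : ℝ) ^ 9 = B at *
  have hB0 : 0 < B := by linarith
  -- A layer of B = y^9 vertices advances time by B/ℓ, so B times the sum is a Riemann sum for ℓ I.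
  -- All losses are at most B times the left side of `hyκ`, hence at most κ B y ≤ κ ℓ.
  have hsum := le_sum_rate hε0 hε1 hr (div_pos hℓ hB0) (y ^ 9)
  generalize ∑ i ∈ Finset.range (y ^ 9), rate ε r (i / (ℓ / B)) = S at *
  generalize Real.log y = ly at *
  have h1 := mul_le_mul_of_nonneg_left hsum hB0.le
  have h6 : B * (rate ε r 0 + ℓ / B * thresholdI ε r) = B * rate ε r 0 + ℓ * thresholdI ε r := by
    field_simp
  have h7 := mul_le_mul_of_nonneg_right hyℓ hκ
  have h8 := mul_le_mul_of_nonneg_left hyκ hB0.le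
  have h9 : 0 ≤ (B - 3) * ly := mul_nonneg (by linarith) hlogy
  rw [h6] at h1
  linarith

/-- A lower bound for the probability to grow layers of the prescribed sizes. -/
lemma exp_le_growProb (hε0 : 0 < ε) (hε1 : ε < 1) (hr : 0 < r) {κ : ℝ} {n N y : ℕ} {p₂ p₃ : ℝ}
    (h₂ : p₂ ∈ Set.Icc (0 : ℝ) 1) (h₃ : p₃ ∈ Set.Icc (0 : ℝ) 1)
    (hp₂ : p₂ = (1 - ε) / n) (hp₃ : p₃ = r / (n * Real.log n))
    (hy : 5 ≤ y) (hyr : 1 + r ≤ y) (hyr' : 4 ≤ r * y) (hyℓ : (y : ℝ) ^ 10 ≤ Real.log n)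
    (hℓy : Real.log n ≤ 2 * (y : ℝ) ^ 10) (hyn : (y : ℝ) ^ 100 ≤ n)
    (hN : n * (1 - 1 / (y : ℝ) ^ 20) ≤ N)
    (hyκ : 16 - Real.log ((1 - ε) / 2) - rate ε r 0 + 101 * Real.log y ≤ κ * y) (hκ : 0 ≤ κ) :
    Real.exp (Real.log n * (thresholdI ε r - κ)) ≤ growProb p₂ p₃ N (layerSizes y) 0 1 := by
  have hy5 : (5 : ℝ) ≤ y := by exact_mod_cast hy
  have hy1 : (1 : ℝ) ≤ y := by linarith
  have htail := fun (d l b : ℕ) (x : ℝ) (hd : d ≤ y ^ 19) (hl : l ≤ y ^ 16) (hb : 1 ≤ b)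
      (hb' : b ≤ y ^ 23) (hx0 : 0 < x) (hx1 : x ≤ 1) =>
    exp_le_binomTail_linkProb (x := x) hε0 hε1 hr h₂ h₃ hp₂ hp₃ hy hyr hyℓ hyn hN hd hl hb hb'
      hx0 hx1
  have htail0 : ∀ d l b, 0 ≤ binomTail (linkProb p₂ p₃ d l) N b := fun d l b =>
    binomTail_nonneg (linkProb_mem_Icc h₂ h₃ d l).1 (linkProb_mem_Icc h₂ h₃ d l).2 N b
  clear hyn hN h₂ h₃ hp₂ hp₃ hyr
  set ℓ := Real.log n with hℓdef
  have hℓ : 0 < ℓ := lt_of_lt_of_le (by positivity) hyℓ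
  set η := 2 / (y : ℝ) ^ 20 with hη
  have hη0 : 0 ≤ η := by positivity
  have hηy : η * (y : ℝ) ^ 18 ≤ 1 := by
    rw [hη, div_mul_eq_mul_div, div_le_one (by positivity)]
    calc 2 * (y : ℝ) ^ 18 ≤ (y * y) * (y : ℝ) ^ 18 := by
          apply mul_le_mul_of_nonneg_right _ (by positivity); nlinarith
      _ = (y : ℝ) ^ 20 := by ring
  have hη2 : η ≤ 1 / 2 := by
    have : (2 : ℝ) ≤ (y : ℝ) ^ 18 :=
      (show (2 : ℝ) ≤ y by linarith).trans (le_self_pow₀ hy1 (by norm_num))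
    have := mul_le_mul_of_nonneg_left this hη0
    linarith
  have hfinal := le_sum_layers hε0 hε1 hr hy hyℓ hη0 hη2 hηy hyκ hκ
  set Q := 3 + 23 * Real.log y with hQ
  have hpow : ∀ k, 1 ≤ y ^ k := fun k => Nat.one_le_pow _ _ (by omega)
  have hle : ∀ {i j : ℕ}, i ≤ j → y ^ i ≤ y ^ j := fun h => Nat.pow_le_pow_right (by omega) h
  have hBB : y ^ 9 * y ^ 9 = y ^ 18 := by ring
  have hd19 : 1 + y ^ 18 + y ^ 9 ≤ y ^ 19 := by
    have : 5 * y ^ 18 ≤ y ^ 19 := by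
      rw [pow_succ y 18, mul_comm]; exact Nat.mul_le_mul_left _ hy
    have := hle (show 9 ≤ 18 by norm_num)
    have := hpow 18
    omega
  have hη1 : 0 < 1 - η := by linarith
  have hB1 : (1 : ℝ) ≤ (y : ℝ) ^ 9 := one_le_pow₀ hy1
  -- Without earlier vertices λ = 1 - ε, so one vertex has at least (1 - ε)/2 expected links, which
  -- is x b. The cost, of order y^9 ln y, is negligible against ℓ.
  have hfirst : Real.exp ((y : ℝ) ^ 9 * (Real.log ((1 - ε) / 2) - 9 * Real.log y) - Q)
      ≤ binomTail (linkProb p₂ p₃ 0 1) N (y ^ 9) := by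
    have hx0 : 0 < (1 - ε) / 2 / (y : ℝ) ^ 9 := div_pos (by linarith) (by linarith)
    have hx1 : (1 - ε) / 2 / (y : ℝ) ^ 9 ≤ 1 := by rw [div_le_one (by linarith)]; linarith
    refine le_trans (Real.exp_le_exp.2 ?_) (htail 0 1 (y ^ 9) ((1 - ε) / 2 / (y : ℝ) ^ 9)
      (Nat.zero_le _) (hpow 16) (hpow 9) (hle (by norm_num)) hx0 hx1 ?_)
    · rw [Real.log_div (x := (1 - ε) / 2) (y := (y : ℝ) ^ 9) (by linarith) (by linarith),
        Real.log_pow, Nat.cast_pow]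
      refine sub_le_sub_right (mul_le_mul_of_nonneg_left ?_ (by linarith)) _
      push_cast
      linarith
    · rw [Nat.cast_pow, div_mul_cancel₀ _ (by linarith)]
      simp only [lam, Nat.cast_zero, Nat.cast_one, zero_div, mul_zero, add_zero, one_mul]
      nlinarith
  have hmiddle : ∀ i ∈ Finset.range (y ^ 9),
      Real.exp ((y : ℝ) ^ 9 * (rate ε r (i / (ℓ / (y : ℝ) ^ 9)) + Real.log (1 - η)) - Q)
        ≤ binomTail (linkProb p₂ p₃ (1 + i * y ^ 9) (y ^ 9)) N (y ^ 9) := by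
    intro i hi
    rw [Finset.mem_range] at hi
    have hiB : i * y ^ 9 ≤ y ^ 18 := by rw [← hBB]; exact Nat.mul_le_mul_right _ hi.le
    have hw : (0 : ℝ) ≤ i / (ℓ / (y : ℝ) ^ 9) := by positivity
    have hm0 := min_one_lam_pos hε1 hr hw
    have hm1 : min 1 (lam ε r (i / (ℓ / (y : ℝ) ^ 9))) ≤ 1 := min_le_left _ _
    have hmlam : min 1 (lam ε r (i / (ℓ / (y : ℝ) ^ 9)))
        ≤ lam ε r ((1 + i * y ^ 9 : ℕ) / ℓ) := by
      refine (min_le_right _ _).trans (lam_mono hr ?_)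
      rw [div_div_eq_mul_div]
      push_cast
      gcongr
      linarith
    have hrate : rate ε r (i / (ℓ / (y : ℝ) ^ 9)) = 1 - min 1 (lam ε r (i / (ℓ / (y : ℝ) ^ 9)))
      + Real.log (min 1 (lam ε r (i / (ℓ / (y : ℝ) ^ 9)))) := rfl
    rw [hrate]
    generalize min 1 (lam ε r (i / (ℓ / (y : ℝ) ^ 9))) = m at *
    refine le_trans (Real.exp_le_exp.2 ?_) (htail (1 + i * y ^ 9) (y ^ 9) (y ^ 9) ((1 - η) * m)
      (by omega) (hle (by norm_num)) (hpow 9) (hle (by norm_num)) (mul_pos hη1 hm0)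
      (mul_le_one₀ (by linarith) hm0.le hm1) ?_)
    · rw [Real.log_mul hη1.ne' hm0.ne', Nat.cast_pow]
      refine sub_le_sub_right (mul_le_mul_of_nonneg_left ?_ (by linarith)) _
      have := mul_nonneg hη0 hm0.le
      linarith
    · rw [mul_assoc]
      refine mul_le_mul_of_nonneg_left ?_ hη1.le
      rw [mul_comm]
      exact mul_le_mul_of_nonneg_left hmlam (Nat.cast_nonneg _)
  -- Since ℓ ≤ 2 y^10, time is now at least y^8 / 2, and r y ≥ 4 gives the bound.
  have hlam : ∀ d : ℕ, y ^ 18 ≤ d → (2 : ℝ) * (y : ℝ) ^ 7 ≤ lam ε r (d / ℓ) := by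
    intro d hd
    have hd' : (y : ℝ) ^ 18 ≤ d := by exact_mod_cast hd
    have h1 : (y : ℝ) ^ 8 / 2 ≤ d / ℓ := by
      rw [div_le_div_iff₀ (by norm_num) hℓ]
      calc (y : ℝ) ^ 8 * ℓ ≤ (y : ℝ) ^ 8 * (2 * (y : ℝ) ^ 10) := by gcongr
        _ = (y : ℝ) ^ 18 * 2 := by ring
        _ ≤ d * 2 := by gcongr
    have h2 := mul_le_mul_of_nonneg_left h1 hr.le
    have h3 := mul_le_mul_of_nonneg_right hyr' (show (0 : ℝ) ≤ (y : ℝ) ^ 7 / 2 by positivity)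
    unfold lam
    have h4 : r * ((y : ℝ) ^ 8 / 2) = r * y * ((y : ℝ) ^ 7 / 2) := by ring
    linarith
  -- The expected number of links is at least (1 - η) 2 y^7 y^k ≥ y^(k+7), so x = 1 is allowed and
  -- the exponential cost disappears.
  have hlast : ∀ d k : ℕ, y ^ 18 ≤ d → d ≤ y ^ 19 → k ≤ 16 →
      Real.exp (-Q) ≤ binomTail (linkProb p₂ p₃ d (y ^ k)) N (y ^ (k + 7)) := by
    intro d k hd hd' hk
    have := htail d (y ^ k) (y ^ (k + 7)) 1 hd' (hle hk) (hpow _) (hle (by omega)) one_pos le_rfl ?_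
    · simpa using this
    · have h1 := hlam d hd
      push_cast
      calc (1 : ℝ) * (y : ℝ) ^ (k + 7) = 1 / 2 * ((y : ℝ) ^ k * (2 * (y : ℝ) ^ 7)) := by ring
        _ ≤ (1 - η) * ((y : ℝ) ^ k * lam ε r (d / ℓ)) := by
            refine mul_le_mul (by linarith) ?_ (by positivity) hη1.le
            exact mul_le_mul_of_nonneg_left h1 (by positivity)
  have hl1 := hlast (1 + y ^ 9 * y ^ 9) 9 (by omega) (by omega) (by norm_num)
  have hl2 := hlast (1 + y ^ 9 * y ^ 9 + y ^ 9) 16 (by omega) (by omega) (by norm_num)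
  have hprod : Real.exp (∑ i ∈ Finset.range (y ^ 9),
      ((y : ℝ) ^ 9 * (rate ε r (i / (ℓ / (y : ℝ) ^ 9)) + Real.log (1 - η)) - Q))
      ≤ ∏ i ∈ Finset.range (y ^ 9),
        binomTail (linkProb p₂ p₃ (1 + i * y ^ 9) (y ^ 9)) N (y ^ 9) := by
    rw [Real.exp_sum]
    exact Finset.prod_le_prod (fun i _ => (Real.exp_pos _).le) hmiddle
  have hgrow : growProb p₂ p₃ N (layerSizes y) 0 1
      = binomTail (linkProb p₂ p₃ 0 1) N (y ^ 9) *
        ((∏ i ∈ Finset.range (y ^ 9),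
            binomTail (linkProb p₂ p₃ (1 + i * y ^ 9) (y ^ 9)) N (y ^ 9)) *
          (binomTail (linkProb p₂ p₃ (1 + y ^ 9 * y ^ 9) (y ^ 9)) N (y ^ 16) *
            binomTail (linkProb p₂ p₃ (1 + y ^ 9 * y ^ 9 + y ^ 9) (y ^ 16)) N (y ^ 23))) := by
    rw [layerSizes, growProb, growProb_replicate_append]
    simp [growProb]
  rw [hgrow]
  refine (Real.exp_le_exp.2 hfinal).trans ?_
  rw [Real.exp_add, Real.exp_add, Real.exp_add]
  have e0 := fun x : ℝ => (Real.exp_pos x).le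
  exact mul_le_mul hfirst (mul_le_mul hprod (mul_le_mul hl1 hl2 (e0 _) (htail0 _ _ _))
    (mul_nonneg (e0 _) (e0 _)) ((e0 _).trans hprod))
    (mul_nonneg (e0 _) (mul_nonneg (e0 _) (e0 _))) (htail0 _ _ _)

end Supercritical

/-! ### The case I > -1 -/

section Limit

variable {ε r : ℝ}

open Classical in
/-- A lower bound for the probability that the random hypergraph is propagation connected. -/
lemma expect_not_propagationConnected_le_exp (hε0 : 0 < ε) (hε1 : ε < 1) (hr : 0 < r) {n y : ℕ}
    {p₂ p₃ : ℝ} (h₂ : p₂ ∈ Set.Icc (0 : ℝ) 1) (h₃ : p₃ ∈ Set.Icc (0 : ℝ) 1)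
    (hp₂ : p₂ = (1 - ε) / n) (hp₃ : p₃ = r / (n * Real.log n))
    (hy : 5 ≤ y) (hyr : 1 + r ≤ y) (hyr' : 4 ≤ r * y) (hyℓ : (y : ℝ) ^ 10 ≤ Real.log n)
    (hℓy : Real.log n ≤ 2 * (y : ℝ) ^ 10) (hyn : (y : ℝ) ^ 100 ≤ n)
    (hyκ : 16 - Real.log ((1 - ε) / 2) - rate ε r 0 + 101 * Real.log y
      ≤ (1 + thresholdI ε r) / 2 * y) (hI : -1 < thresholdI ε r) :
    expect (edgeProb p₂ p₃) (fun E : Finset (Finset (Fin n)) =>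
        if ¬ (hypergraphOfEdges (edgeSetOf E)).PropagationConnected then 1 else 0)
      ≤ Real.exp (-(Real.exp ((1 + thresholdI ε r) / 2 * Real.log n) / (2 * Real.log n ^ 5)))
        + Real.exp (-Real.log n) := by
  have hy5 : (5 : ℝ) ≤ y := by exact_mod_cast hy
  have hy1 : (1 : ℝ) ≤ y := by linarith
  have hy0 : (0 : ℝ) < y := by linarith
  have hn0 : (0 : ℝ) < n := lt_of_lt_of_le (by positivity) hyn
  have hn3 : 3 ≤ n := by
    have : (3 : ℝ) ≤ n :=
      (show (3 : ℝ) ≤ y by linarith).trans ((le_self_pow₀ hy1 (by norm_num)).trans hyn)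
    exact_mod_cast this
  have hℓ : 0 < Real.log n := lt_of_lt_of_le (by positivity) hyℓ
  have hexp : Real.exp (Real.log n) = n := Real.exp_log hn0
  -- Each attempt uses at most y^24 vertices, so all of them together use at most n / y^26, leaving
  -- the share 1 - 1/y^20 that the tail bounds require.
  set m := n / y ^ 50 with hm
  have hm_le : (m : ℝ) ≤ n / (y : ℝ) ^ 50 := by
    have := Nat.cast_div_le (α := ℝ) (m := n) (n := y ^ 50)
    push_cast at this; exact this
  have hm_ge : (n : ℝ) / (2 * (y : ℝ) ^ 50) ≤ m := by
    have h1 : (n : ℝ) / (y : ℝ) ^ 50 < m + 1 := by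
      rw [div_lt_iff₀ (by positivity)]
      have := Nat.lt_div_mul_add (a := n) (b := y ^ 50) (by positivity)
      rw [← hm] at this
      have h2 : (n : ℝ) < m * (y : ℝ) ^ 50 + (y : ℝ) ^ 50 := by exact_mod_cast this
      linarith
    have h2 : (2 : ℝ) ≤ n / (y : ℝ) ^ 50 := by
      rw [le_div_iff₀ (by positivity)]
      calc 2 * (y : ℝ) ^ 50 ≤ y * (y : ℝ) ^ 50 := by gcongr; linarith
        _ = (y : ℝ) ^ 51 := by ring
        _ ≤ (y : ℝ) ^ 100 := pow_le_pow_right₀ hy1 (by norm_num)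
        _ ≤ n := hyn
    have h3 : (n : ℝ) / (2 * (y : ℝ) ^ 50) = n / (y : ℝ) ^ 50 / 2 := by ring
    linarith
  set K := 1 + (layerSizes y).sum with hK
  have hmK : ((m * K : ℕ) : ℝ) ≤ n * (1 / (y : ℝ) ^ 20) := by
    have h1 : (K : ℝ) ≤ (y : ℝ) ^ 24 := by exact_mod_cast one_add_sum_layerSizes_le hy
    push_cast
    calc (m : ℝ) * K ≤ n / (y : ℝ) ^ 50 * (y : ℝ) ^ 24 := by gcongr
      _ = n * (1 / (y : ℝ) ^ 26) := by field_simp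
      _ ≤ n * (1 / (y : ℝ) ^ 20) := by
          gcongr; norm_num
  have hmK' : m * K ≤ n := by
    have h1 : (1 : ℝ) / (y : ℝ) ^ 20 ≤ 1 := by
      rw [div_le_one (by positivity)]; exact one_le_pow₀ hy1
    have : ((m * K : ℕ) : ℝ) ≤ n := by nlinarith
    exact_mod_cast this
  set N := n - m * K with hNdef
  have hN : n * (1 - 1 / (y : ℝ) ^ 20) ≤ (N : ℝ) := by
    rw [hNdef, Nat.cast_sub hmK']; linarith
  have hs := exp_le_growProb hε0 hε1 hr h₂ h₃ hp₂ hp₃ hy hyr hyr' hyℓ hℓy hyn hN hyκ (by linarith)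
  have hs1 := (growProb_mem_Icc h₂ h₃ N (layerSizes y) 0 1).2
  set s := growProb p₂ p₃ N (layerSizes y) 0 1
  -- The last layer is large enough for the first moment bound: ℓ² ≤ 4 y^20 and 4 ≤ r y give 12 ℓ² /
  -- r ≤ 12 y^21.
  have hM : 12 * Real.log n ^ 2 / r + 1 ≤ (y ^ 23 : ℕ) := by
    have h1 : Real.log n ^ 2 ≤ (2 * (y : ℝ) ^ 10) ^ 2 := pow_le_pow_left₀ hℓ.le hℓy 2
    have h2 : 12 * Real.log n ^ 2 / r ≤ 12 * (y : ℝ) ^ 21 := by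
      rw [div_le_iff₀ hr]
      have h3 := mul_le_mul_of_nonneg_left hyr' (show 0 ≤ 12 * (y : ℝ) ^ 20 by positivity)
      have e1 : (2 * (y : ℝ) ^ 10) ^ 2 = 4 * (y : ℝ) ^ 20 := by ring
      have e2 : 12 * (y : ℝ) ^ 20 * (r * y) = 12 * (y : ℝ) ^ 21 * r := by ring
      linarith
    have h4 : (1 : ℝ) ≤ (y : ℝ) ^ 21 := one_le_pow₀ hy1
    have h5 : 25 * (y : ℝ) ^ 21 ≤ (y : ℝ) ^ 23 := by
      calc 25 * (y : ℝ) ^ 21 = 5 * 5 * (y : ℝ) ^ 21 := by ring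
        _ ≤ y * y * (y : ℝ) ^ 21 := by gcongr
        _ = (y : ℝ) ^ 23 := by ring
    push_cast
    linarith
  refine (expect_not_propagationConnected_le h₂ h₃ (V := Fin n) (N := N) (M := y ^ 23) (m := m)
    (bs := layerSizes y) ?_ ?_).trans (add_le_add ?_ ?_)
  · rw [Fintype.card_fin, hNdef]; exact (Nat.sub_add_cancel hmK').le
  · rw [layerSizes, List.getLastD_cons, List.getLastD_eq_getLast?, List.getLast?_append]; simp
  · have h1 : (1 - s) ^ m ≤ Real.exp (-s) ^ m :=
      pow_le_pow_left₀ (sub_nonneg.2 hs1) (by linarith [Real.add_one_le_exp (-s)]) m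
    refine h1.trans ?_
    rw [← Real.exp_nat_mul, Real.exp_le_exp, mul_neg, neg_le_neg_iff]
    have h2 : (y : ℝ) ^ 50 ≤ Real.log n ^ 5 := by
      calc (y : ℝ) ^ 50 = ((y : ℝ) ^ 10) ^ 5 := by ring
        _ ≤ _ := pow_le_pow_left₀ (by positivity) hyℓ 5
    -- The choice κ = (1 + I)/2 gives n · n^(I-κ) = n^κ, so the expected number of successes still
    -- grows after division by the power of ℓ.
    have h3 : Real.exp ((1 + thresholdI ε r) / 2 * Real.log n)
        = n * Real.exp (Real.log n * (thresholdI ε r - (1 + thresholdI ε r) / 2)) := by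
      conv_rhs => rw [← hexp, ← Real.exp_add, hexp]
      congr 1; ring
    calc Real.exp ((1 + thresholdI ε r) / 2 * Real.log n) / (2 * Real.log n ^ 5)
        ≤ Real.exp ((1 + thresholdI ε r) / 2 * Real.log n) / (2 * (y : ℝ) ^ 50) := by gcongr
      _ = n / (2 * (y : ℝ) ^ 50)
          * Real.exp (Real.log n * (thresholdI ε r - (1 + thresholdI ε r) / 2)) := by
          rw [h3, div_mul_eq_mul_div]
      _ ≤ m * s := by gcongr
  · rw [Fintype.card_fin]
    exact sum_choose_mul_le hr hn3 h₃ hp₃ hM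

lemma tendsto_floor_log_rpow :
    Tendsto (fun n : ℕ => ⌊Real.log n ^ (1 / 10 : ℝ)⌋₊) atTop atTop :=
  tendsto_nat_floor_atTop.comp ((tendsto_rpow_atTop (by norm_num)).comp tendsto_log_natCast)

/-- With y the integer part of ℓ^(1/10), all conditions on y hold eventually, and both failure terms
tend to 0 because n^κ outgrows ℓ^5. -/
lemma tendsto_propagationConnected (hε0 : 0 < ε) (hε1 : ε < 1) (hr : 0 < r)
    {p₂ p₃ : ℕ → unitInterval}
    (hp₂ : ∀ᶠ n : ℕ in atTop, (p₂ n : ℝ) = (1 - ε) / n)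
    (hp₃ : ∀ᶠ n : ℕ in atTop, (p₃ n : ℝ) = r / (n * Real.log n))
    (hI : -1 < thresholdI ε r) :
    Tendsto (fun n : ℕ => (randomEdges n (p₂ n) (p₃ n)).real
        {ω | (randomHypergraph n ω).PropagationConnected}) atTop (𝓝 1) := by
  classical
  set κ := (1 + thresholdI ε r) / 2 with hκ
  have hκ0 : 0 < κ := by rw [hκ]; linarith
  set y : ℕ → ℕ := fun n => ⌊Real.log n ^ (1 / 10 : ℝ)⌋₊ with hy
  have hlim : Tendsto (fun n : ℕ => 1 - (Real.exp (-(Real.exp (κ * Real.log n) /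
      (2 * Real.log n ^ 5))) + Real.exp (-Real.log n))) atTop (𝓝 1) := by
    have h1 : Tendsto (fun n : ℕ => Real.exp (κ * Real.log n) / (2 * Real.log n ^ 5))
        atTop atTop := by
      have h2 := ((Real.tendsto_exp_div_pow_atTop 5).comp
        (tendsto_log_natCast.const_mul_atTop hκ0)).const_mul_atTop
          (show 0 < κ ^ 5 / 2 by positivity)
      refine h2.congr fun n => ?_
      simp only [Function.comp]
      rw [mul_pow, div_mul_div_comm, mul_left_comm, mul_div_mul_left _ _ (by positivity)]
    have h3 := (Real.tendsto_exp_neg_atTop_nhds_zero.comp h1).add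
      (Real.tendsto_exp_neg_atTop_nhds_zero.comp tendsto_log_natCast)
    simpa using h3.const_sub 1
  have hyκ : ∀ᶠ y : ℕ in atTop,
      16 - Real.log ((1 - ε) / 2) - rate ε r 0 + 101 * Real.log y ≤ κ * y := by
    have h1 : (fun y : ℕ => Real.log y) =o[atTop] (fun y : ℕ => (y : ℝ)) :=
      Real.isLittleO_log_id_atTop.comp_tendsto tendsto_natCast_atTop_atTop
    have h2 : ∀ᶠ y : ℕ in atTop,
        16 - Real.log ((1 - ε) / 2) - rate ε r 0 ≤ κ / 2 * (y : ℝ) :=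
      (tendsto_natCast_atTop_atTop.const_mul_atTop (by positivity)).eventually_ge_atTop _
    filter_upwards [h1.bound (show 0 < κ / 202 by positivity), h2] with y h3 h4
    rw [Real.norm_of_nonneg (Real.log_natCast_nonneg y), Real.norm_of_nonneg (by positivity)] at h3
    linarith
  have hlogpow : ∀ᶠ n : ℕ in atTop, Real.log n ^ 10 ≤ n := by
    have h1 : (fun n : ℕ => Real.log n ^ 10) =o[atTop] (fun n : ℕ => (n : ℝ)) :=
      Real.isLittleO_pow_log_id_atTop.comp_tendsto tendsto_natCast_atTop_atTop
    filter_upwards [h1.bound one_pos] with n hn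
    have h2 := Real.log_natCast_nonneg n
    rwa [Real.norm_of_nonneg (by positivity), Real.norm_of_nonneg (by positivity), one_mul] at hn
  refine tendsto_of_tendsto_of_tendsto_of_le_of_le' hlim tendsto_const_nhds ?_ ?_
  · filter_upwards [hp₂, hp₃, hlogpow, tendsto_floor_log_rpow.eventually hyκ,
      tendsto_floor_log_rpow.eventually (eventually_ge_atTop 20),
      (tendsto_natCast_atTop_atTop (R := ℝ)).comp tendsto_floor_log_rpow
        |>.eventually_ge_atTop (1 + r),
      (tendsto_natCast_atTop_atTop (R := ℝ)).comp tendsto_floor_log_rpow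
        |>.eventually_ge_atTop (4 / r)] with n hn₂ hn₃ hnlog hnκ hy20 hyr hyr'
    simp only [Function.comp] at hyr hyr'
    rw [div_le_iff₀' hr] at hyr'
    have hℓ := Real.log_natCast_nonneg n
    have hroot : (Real.log n ^ (1 / 10 : ℝ)) ^ 10 = Real.log n := by
      rw [← Real.rpow_natCast, ← Real.rpow_mul hℓ]; norm_num
    have hroot0 : 0 ≤ Real.log n ^ (1 / 10 : ℝ) := by positivity
    have hfl := Nat.floor_le hroot0
    have hfl' := Nat.lt_floor_add_one (Real.log n ^ (1 / 10 : ℝ))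
    generalize ⌊Real.log n ^ (1 / 10 : ℝ)⌋₊ = y at *
    have hy20' : (20 : ℝ) ≤ y := by exact_mod_cast hy20
    have hyℓ : (y : ℝ) ^ 10 ≤ Real.log n := by
      rw [← hroot]; exact pow_le_pow_left₀ (by positivity) hfl 10
    -- Rounding costs at most a factor 21/20 when y ≥ 20, and (21/20)^10 ≤ 2.
    have hℓy : Real.log n ≤ 2 * (y : ℝ) ^ 10 := by
      rw [← hroot]
      calc (Real.log n ^ (1 / 10 : ℝ)) ^ 10 ≤ (21 / 20 * (y : ℝ)) ^ 10 :=
            pow_le_pow_left₀ hroot0 (by linarith) 10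
        _ = (21 / 20) ^ 10 * (y : ℝ) ^ 10 := mul_pow _ _ _
        _ ≤ 2 * (y : ℝ) ^ 10 := by gcongr; norm_num
    have hyn : (y : ℝ) ^ 100 ≤ n := by
      calc (y : ℝ) ^ 100 = ((y : ℝ) ^ 10) ^ 10 := by ring
        _ ≤ Real.log n ^ 10 := pow_le_pow_left₀ (by positivity) hyℓ 10
        _ ≤ n := hnlog
    have h := expect_not_propagationConnected_le_exp hε0 hε1 hr (p₂ n).2 (p₃ n).2 hn₂ hn₃
      (by omega) hyr hyr' hyℓ hℓy hyn hnκ hI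
    simp only [randomHypergraph]
    rw [measureReal_randomEdges n _ _ fun A => (hypergraphOfEdges A).PropagationConnected]
    have h5 : (fun E : Finset (Finset (Fin n)) =>
        if (hypergraphOfEdges (edgeSetOf E)).PropagationConnected then (1 : ℝ) else 0)
        = fun E => 1 - if ¬ (hypergraphOfEdges (edgeSetOf E)).PropagationConnected then 1 else 0 := by
      funext E; split_ifs <;> simp
    rw [h5, expect_sub, expect_const]
    linarith
  · refine Eventually.of_forall fun n => ?_
    have : IsProbabilityMeasure (randomEdges n (p₂ n) (p₃ n)) := by
      unfold randomEdges; infer_instance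
    exact measureReal_le_one

end Limit

theorem theorem2 (ε r : ℝ) (hε0 : 0 < ε) (hε1 : ε < 1) (hr : 0 < r)
    (p₂ p₃ : ℕ → unitInterval)
    (hp₂ : ∀ᶠ n : ℕ in atTop, (p₂ n : ℝ) = (1 - ε) / n)
    (hp₃ : ∀ᶠ n : ℕ in atTop, (p₃ n : ℝ) = r / (n * Real.log n)) :
    thresholdI ε r = -(1 / r) * (ε - ε ^ 2 / 2 + (1 - ε) * Real.log (1 - ε)) ∧
    (thresholdI ε r < -1 →
      Tendsto (fun n : ℕ => (randomEdges n (p₂ n) (p₃ n)).real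
        {ω | ¬ (randomHypergraph n ω).PropagationConnected}) atTop (𝓝 1)) ∧
    (-1 < thresholdI ε r →
      Tendsto (fun n : ℕ => (randomEdges n (p₂ n) (p₃ n)).real
        {ω | (randomHypergraph n ω).PropagationConnected}) atTop (𝓝 1)) :=
  ⟨thresholdI_eq hε0 hε1 hr, tendsto_not_propagationConnected hε0 hε1 hr hp₂ hp₃,
    tendsto_propagationConnected hε0 hε1 hr hp₂ hp₃⟩
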